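/- Let $0<\alpha<2$, $0<H<1$ and $\rho\ge 0$. On a probability space let $(\Gamma_n)_{n\ge1}$ be the arrival times of a Poisson process of rate $1$ on $[0,\infty)$, let $(G_n)_{n\ge1}$ be standard normal variables, let $(X_n)_{n\ge1}$ be random variables with density $e^{-2|x|}$ on $\mathbb R$, and let $(f_n)_{n\ge1}$ be copies of a non-negative continuous random function $\mathbb R\times\mathbb R_+\to\mathbb R$, the sequence $(\Gamma_n)_n$ and all the $G_n$, $X_n$, $f_n$ being independent. Suppose that for all compact $K\subset\mathbb R_+$ and all $r>0$, $\sup_{x\in\mathbb R}\mathbb E\big[\sup_{t\in K}f_n(x,t)^r\big]<\infty$, and that there are fractional Brownian motions $B^{H,n}$ of Hurst parameter $H$, with continuous paths and defined on the same space, such that almost surely, for every $t\ge 0$, the support of $f_n(\cdot,t)$ is contained in $\big[\inf_{s\le t}B^{H,n}_s-\rho,\ \sup_{s\le t}B^{H,n}_s+\rho\big]$. Put $$Y_P(t)=\sum_{n=1}^{P}\Gamma_n^{-1/\alpha}\,G_n\,e^{2|X_n|/\alpha}f_n(X_n,t),\qquad Y(t)=\lim_{P\to\infty}Y_P(t),\qquad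 t\ge 0,$$ (when $f_n$ is the local time of $B^{H,n}$, this is the series of local time fractional stable motion, LTFSM) and $\|g\|_{K,p}=\big(\int_K|g(t)|^p\,dt\big)^{1/p}$. For every $t\ge0$ the limit $Y(t)$ exists almost surely. Moreover, for every compact $K\subset\mathbb R_+$, every $p>0$ and every $q>\max(p,2)$ there is a constant $C$ such that, for all integers $P$ with $(P+1)\alpha>q$, $$\mathbb E\big[\|Y-Y_P\|_{K,p}^{q}\big]\le \frac{C}{P^{\,q\frac{2-\alpha}{2\alpha}}}.$$ -/

import Mathlib

open MeasureTheory ProbabilityTheory Filter Topology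
open scoped NNReal ENNReal

noncomputable section

namespace ShotNoise

/-- Lebesgue measure on the half-line `ℝ₊ = [0, ∞)`. -/
def lebesgueHalfLine : Measure ℝ≥0 :=
  (volume : Measure ℝ).comap ((↑) : ℝ≥0 → ℝ)

/-- The Laplace distribution with parameters `(0, 1/2)`: density `x ↦ exp (-2|x|)` on `ℝ`. -/
def laplaceLaw : Measure ℝ :=
  (volume : Measure ℝ).withDensity (fun x => ENNReal.ofReal (Real.exp (-2 * |x|)))

/-- The uniform norm `‖g‖_K = sup_{t ∈ K} |g t|`, with values in `[0, ∞]`. -/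
def supNormOn (K : Set ℝ≥0) (g : ℝ≥0 → ℝ) : ℝ≥0∞ :=
  ⨆ t ∈ K, ‖g t‖ₑ

/-- The `L^p(K)` norm `‖g‖_{K,p} = (∫_K |g t|^p dt)^{1/p}`, `0 < p < ∞`,
with values in `[0, ∞]`. -/
def lpNormOn (K : Set ℝ≥0) (p : ℝ) (g : ℝ≥0 → ℝ) : ℝ≥0∞ :=
  eLpNorm g (ENNReal.ofReal p) (lebesgueHalfLine.restrict K)

section Model

variable {Ω : Type*} [MeasurableSpace Ω]

/-- Fractional Brownian motion of Hurst parameter `H` on `ℝ₊`: a centred Gaussian process with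
covariance `(s^{2H} + t^{2H} - |t - s|^{2H}) / 2` and almost surely continuous paths. -/
structure IsFractionalBrownianMotion (H : ℝ) (B : ℝ≥0 → Ω → ℝ) (μ : Measure Ω) : Prop where
  isGaussian : IsGaussianProcess B μ
  centred : ∀ t, ∫ ω, B t ω ∂μ = 0
  covariance_eq : ∀ s t : ℝ≥0, covariance (B s) (B t) μ =
    ((s : ℝ) ^ (2 * H) + (t : ℝ) ^ (2 * H) - |(t : ℝ) - (s : ℝ)| ^ (2 * H)) / 2
  continuous_paths : ∀ᵐ ω ∂μ, Continuous (fun t => B t ω)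

/-- The waiting times `Γ₁, Γ₂ - Γ₁, Γ₃ - Γ₂, …` of a sequence of arrival times; `Γ n` is the
`(n+1)`-st arrival time. -/
def waitingTime (Γ : ℕ → Ω → ℝ) : ℕ → Ω → ℝ
  | 0 => Γ 0
  | n + 1 => fun ω => Γ (n + 1) ω - Γ n ω

/-- `Γ 0, Γ 1, …` are the successive arrival times of a Poisson process of rate `1` on `ℝ₊`:
the waiting times are independent and exponentially distributed with parameter `1`. -/
structure IsPoissonArrivals (Γ : ℕ → Ω → ℝ) (μ : Measure Ω) : Prop where
  measurable : ∀ n, Measurable (Γ n)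
  indep : iIndepFun (waitingTime Γ) μ
  law : ∀ n, HasLaw (waitingTime Γ n) (expMeasure 1) μ

/-- Labels for the sources of randomness: the arrival times (as one sequence), and each of the
variables `G n`, `X n` and each of the random functions `f n`. -/
inductive Source : Type
  | arrivals : Source
  | gaussian (n : ℕ) : Source
  | laplace (n : ℕ) : Source
  | field (n : ℕ) : Source

/-- The σ-algebra generated by each source of randomness. A random function is regarded as a
random element of `ℝ → ℝ≥0 → ℝ` with the product σ-algebra. -/
def sourceSigma (Γ G X : ℕ → Ω → ℝ) (f : ℕ → Ω → ℝ → ℝ≥0 → ℝ) : Source → MeasurableSpace Ω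
  | .arrivals => ⨆ n, MeasurableSpace.comap (Γ n) inferInstance
  | .gaussian n => MeasurableSpace.comap (G n) inferInstance
  | .laplace n => MeasurableSpace.comap (X n) inferInstance
  | .field n => MeasurableSpace.comap (f n) inferInstance

/-- The probabilistic setting of the series. All sequences start at index `0`, so that index `n`
stands for the `(n+1)`-st term. -/
structure IsModel (H ρ : ℝ) (Γ G X : ℕ → Ω → ℝ) (f : ℕ → Ω → ℝ → ℝ≥0 → ℝ)
    (B : ℕ → ℝ≥0 → Ω → ℝ) (μ : Measure Ω) : Prop where
  arrivals : IsPoissonArrivals Γ μ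
  measurable_gaussian : ∀ n, Measurable (G n)
  law_gaussian : ∀ n, HasLaw (G n) (gaussianReal 0 1) μ
  measurable_laplace : ∀ n, Measurable (X n)
  law_laplace : ∀ n, HasLaw (X n) laplaceLaw μ
  measurable_field : ∀ n, Measurable (f n)
  /-- the `f n` are copies of one random function -/
  identDistrib_field : ∀ n, IdentDistrib (f n) (f 0) μ μ
  /-- all the variables are independent -/
  indep : iIndep (sourceSigma Γ G X f) μ
  field_nonneg : ∀ n, ∀ᵐ ω ∂μ, ∀ x t, 0 ≤ f n ω x t
  field_continuous : ∀ n, ∀ᵐ ω ∂μ, Continuous (fun z : ℝ × ℝ≥0 => f n ω z.1 z.2)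
  /-- `E ‖f_n(x, ·)‖_K^p` is bounded uniformly in `x` -/
  field_moments : ∀ n, ∀ K : Set ℝ≥0, IsCompact K → ∀ p : ℝ, 0 < p →
    ∃ M : ℝ≥0, ∀ x : ℝ, ∫⁻ ω, supNormOn K (f n ω x) ^ p ∂μ ≤ (M : ℝ≥0∞)
  fbm : ∀ n, IsFractionalBrownianMotion H (B n) μ
  /-- `f_n(·, t)` is supported in `[inf_{s ≤ t} B_s - ρ, sup_{s ≤ t} B_s + ρ]` -/
  field_support : ∀ n, ∀ᵐ ω ∂μ, ∀ t x, f n ω x t ≠ 0 →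
    x ∈ Set.Icc (sInf ((fun s => B n s ω) '' Set.Iic t) - ρ)
      (sSup ((fun s => B n s ω) '' Set.Iic t) + ρ)

/-- The truncated series
`Y_N(t) = ∑_{n=1}^N Γ_n^{-1/α} G_n e^{2|X_n|/α} f_n(X_n, t)` (indices shifted by one). -/
def truncatedSeries (α : ℝ) (Γ G X : ℕ → Ω → ℝ) (f : ℕ → Ω → ℝ → ℝ≥0 → ℝ)
    (N : ℕ) (ω : Ω) (t : ℝ≥0) : ℝ :=
  ∑ n ∈ Finset.range N,
    (Γ n ω) ^ (-1 / α) * G n ω * Real.exp (2 * |X n ω| / α) * f n ω (X n ω) t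

/-- The series `Y(t) = lim_{N → ∞} Y_N(t)`. It is a limit of partial sums and not an
unconditional sum, since it need not converge absolutely when `α ≥ 1`. -/
def series (α : ℝ) (Γ G X : ℕ → Ω → ℝ) (f : ℕ → Ω → ℝ → ℝ≥0 → ℝ) (ω : Ω) (t : ℝ≥0) : ℝ :=
  limUnder atTop (fun N => truncatedSeries α Γ G X f N ω t)

end Model

end ShotNoise

end

/-! Write w_n(t) for the factor multiplying `G n`. Given all the `Γ n`, `X n` and `f n`, a block of
the series at fixed t is a centred Gaussian variable with variance the sum of the w_n(t)^2. Its q-th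
moment is therefore a constant times the expectation of the (q/2)-th power of that sum
(`lintegral_enorm_sum_mul_gaussian_rpow`), and Minkowski in L^{q/2} reduces the estimate to
E[w_n^q]. By independence this is E[Γ_n^{-q/α}], of order n^{-q/α} because arrival times are Gamma
distributed, times a moment of the shot that is bounded in n. The block from P on is then controlled
by the sum over n ≥ P of n^{-2/α}, of order P^{1-2/α} as α < 2, and the power q/2 gives the rate
(`IsModel.lintegral_sum_Ico_rpow_le`).

The shot contains e^{2|X_n|/α}, so E[f_n(x,t)^q] must decay exponentially in |x|. It does, at every
rate: f_n(x,t) ≠ 0 forces the Gaussian path to reach height about |x|, which is unlikely by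
Fernique's theorem (`IsModel.lintegral_field_rpow_le`).

From a large index on, the partial sums form an L^2-bounded martingale, whence almost sure
convergence at each t. Fatou carries the block bound to the full tail, and Hölder and Tonelli on K
yield the norm estimate. -/

namespace ShotNoise

/-! ### Negative moments of the Gamma laws and tails of power series. -/

lemma gamma_ratio_le {r : ℝ} (hr : 0 < r) :
    ∃ C : ℝ, 0 < C ∧ ∀ n : ℕ, r < n + 1 →
      Real.Gamma (n + 1 - r) / Real.Gamma (n + 1) ≤ C * ((n : ℝ) + 1) ^ (-r) := by
  set a : ℕ → ℝ := fun n => Real.Gamma (n + 1 - r) / Real.Gamma (n + 1) with ha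
  set m := ⌊r⌋₊ with hm
  have hmr : r < m + 1 := Nat.lt_floor_add_one r
  have ha_pos : ∀ n : ℕ, r < n + 1 → 0 < a n := fun n hn =>
    div_pos (Real.Gamma_pos_of_pos (by linarith)) (Real.Gamma_pos_of_pos (by positivity))
  -- Here `m` is the first index with r < m + 1. From it on, a_n (n+1)^r is non-increasing, so its
  -- value at `m` is the constant.
  refine ⟨a m * ((m : ℝ) + 1) ^ r, mul_pos (ha_pos m hmr) (by positivity), ?_⟩
  have key : ∀ n, m ≤ n → a n * ((n : ℝ) + 1) ^ r ≤ a m * ((m : ℝ) + 1) ^ r := by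
    intro n hn
    induction n, hn using Nat.le_induction with
    | base => exact le_rfl
    | succ n hn ih =>
      refine le_trans ?_ ih
      have hnr : r < n + 1 := lt_of_lt_of_le hmr (by exact_mod_cast Nat.succ_le_succ hn)
      have hN : (0 : ℝ) < n + 1 := by positivity
      have h1 : a (n + 1) = a n * (1 - r / (n + 1)) := by
        simp only [ha]
        push_cast
        rw [show ((n : ℝ) + 1 + 1 - r) = (n + 1 - r) + 1 by ring,
          Real.Gamma_add_one (by linarith : (n : ℝ) + 1 - r ≠ 0), Real.Gamma_add_one hN.ne']
        have := (Real.Gamma_pos_of_pos hN).ne'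
        field_simp
      have h2 : ((n : ℝ) + 1 + 1) ^ r = ((n : ℝ) + 1) ^ r * (1 + 1 / (n + 1)) ^ r := by
        rw [← Real.mul_rpow hN.le (by positivity)]
        congr 1
        field_simp
      have h3 : (1 - r / (n + 1)) * (1 + 1 / ((n : ℝ) + 1)) ^ r ≤ 1 := by
        have e1 : 1 - r / ((n : ℝ) + 1) ≤ Real.exp (-(r / (n + 1))) := by
          have := Real.add_one_le_exp (-(r / ((n : ℝ) + 1))); linarith
        have e2 : (1 + 1 / ((n : ℝ) + 1)) ^ r ≤ Real.exp (r / (n + 1)) := by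
          have h := Real.add_one_le_exp (1 / ((n : ℝ) + 1))
          calc (1 + 1 / ((n : ℝ) + 1)) ^ r ≤ (Real.exp (1 / (n + 1))) ^ r :=
                Real.rpow_le_rpow (by positivity) (by linarith) hr.le
            _ = Real.exp (r / (n + 1)) := by
                rw [← Real.exp_mul]; congr 1; ring
        calc _ ≤ Real.exp (-(r / (n + 1))) * Real.exp (r / (n + 1)) :=
              mul_le_mul e1 e2 (by positivity) (by positivity)
          _ = 1 := by rw [← Real.exp_add]; simp
      push_cast
      rw [h1, h2]
      calc a n * (1 - r / (n + 1)) * (((n : ℝ) + 1) ^ r * (1 + 1 / (n + 1)) ^ r)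
          = a n * ((n : ℝ) + 1) ^ r * ((1 - r / (n + 1)) * (1 + 1 / (n + 1)) ^ r) := by ring
        _ ≤ a n * ((n : ℝ) + 1) ^ r * 1 := by
            gcongr
        _ = _ := mul_one _
  intro n hn
  have hmn : m ≤ n := Nat.lt_succ_iff.1 ((Nat.floor_lt hr.le).2 (by push_cast; exact hn))
  have hN : (0 : ℝ) < n + 1 := by positivity
  rw [Real.rpow_neg hN.le, ← div_eq_mul_inv, le_div_iff₀ (by positivity)]
  exact key n hmn

lemma sum_Ico_rpow_neg_le {s : ℝ} (hs : 1 < s) {P N : ℕ} (hP : 1 ≤ P) :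
    ∑ i ∈ Finset.Ico P N, ((i : ℝ) + 1) ^ (-s) ≤ (P : ℝ) ^ (1 - s) / (s - 1) := by
  -- Comparison with the integral of x^{-s} over [u, u+1]; the right-hand sides telescope.
  have step : ∀ u : ℝ, 1 ≤ u → (u + 1) ^ (-s) ≤ (u ^ (1 - s) - (u + 1) ^ (1 - s)) / (s - 1) := by
    intro u hu
    have hu0 : 0 < u := by linarith
    rw [le_div_iff₀ (by linarith)]
    have h1 : (u + 1) ^ (-s) = (u + 1) ^ (1 - s) / (u + 1) := by
      rw [← Real.rpow_sub_one (by positivity)]; congr 1; ring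
    have h2 : 1 + (s - 1) / (u + 1) ≤ ((u + 1) / u) ^ (s - 1) := by
      have h3 : Real.exp (1 / (u + 1)) ≤ (u + 1) / u := by
        have := Real.add_one_le_exp (-(1 / (u + 1)))
        rw [Real.exp_neg] at this
        have h4 : -(1 / (u + 1)) + 1 = u / (u + 1) := by field_simp; ring
        rw [h4] at this
        have := inv_anti₀ (by positivity) this
        rwa [inv_inv, inv_div] at this
      calc 1 + (s - 1) / (u + 1) ≤ Real.exp ((s - 1) / (u + 1)) := by
            have := Real.add_one_le_exp ((s - 1) / (u + 1)); linarith
        _ = Real.exp (1 / (u + 1)) ^ (s - 1) := by rw [← Real.exp_mul]; congr 1; ring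
        _ ≤ _ := Real.rpow_le_rpow (by positivity) h3 (by linarith)
    have h5 : (u + 1) ^ (1 - s) * ((u + 1) / u) ^ (s - 1) = u ^ (1 - s) := by
      rw [Real.div_rpow (by positivity) hu0.le, show s - 1 = -(1 - s) by ring,
        Real.rpow_neg (by positivity), Real.rpow_neg hu0.le]
      have : (u + 1) ^ (1 - s) ≠ 0 := by positivity
      have : u ^ (1 - s) ≠ 0 := by positivity
      field_simp
    have h6 : (u + 1) ^ (1 - s) * (1 + (s - 1) / (u + 1)) ≤ u ^ (1 - s) := by
      rw [← h5]; gcongr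
    rw [h1]
    have : (u + 1) ^ (1 - s) * (1 + (s - 1) / (u + 1))
      = (u + 1) ^ (1 - s) + (u + 1) ^ (1 - s) / (u + 1) * (s - 1) := by ring
    linarith
  rcases le_total P N with h | h
  · have : ∑ i ∈ Finset.Ico P N, ((i : ℝ) + 1) ^ (-s) ≤
        ((P : ℝ) ^ (1 - s) - (N : ℝ) ^ (1 - s)) / (s - 1) := by
      induction N, h using Nat.le_induction with
      | base => simp
      | succ n hn ih =>
        rw [Finset.sum_Ico_succ_top hn]
        have := step n (by exact_mod_cast hP.trans hn)
        push_cast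
        calc _ ≤ _ := add_le_add ih this
          _ = _ := by ring
    refine this.trans ?_
    have : (0 : ℝ) ≤ (N : ℝ) ^ (1 - s) := by positivity
    have : 0 < s - 1 := by linarith
    gcongr
    linarith
  · rw [Finset.Ico_eq_empty_of_le h, Finset.sum_empty]
    have : 0 < s - 1 := by linarith
    positivity

/-- The factor x^{-r} turns the Gamma density of shape a into a multiple of the one of shape a - r.
-/
lemma lintegral_rpow_neg_gammaMeasure {a r : ℝ} (hr : r < a) (ha : 0 < a) :
    ∫⁻ x, ENNReal.ofReal (x ^ (-r)) ∂(gammaMeasure a 1)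
      = ENNReal.ofReal (Real.Gamma (a - r) / Real.Gamma a) := by
  have hga := Real.Gamma_pos_of_pos ha
  have hgr := Real.Gamma_pos_of_pos (sub_pos.2 hr)
  rw [gammaMeasure, lintegral_withDensity_eq_lintegral_mul _ (by unfold gammaPDF; fun_prop) (by fun_prop)]
  have : ∀ᵐ x : ℝ, (gammaPDF a 1 * fun x => ENNReal.ofReal (x ^ (-r))) x =
      ENNReal.ofReal (Real.Gamma (a - r) / Real.Gamma a) * gammaPDF (a - r) 1 x := by
    filter_upwards [Measure.ae_ne volume (0 : ℝ)] with x hx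
    rcases lt_or_gt_of_ne hx with h | h
    · simp [gammaPDF_of_neg h]
    · rw [Pi.mul_apply, gammaPDF_of_nonneg h.le, gammaPDF_of_nonneg h.le,
        ← ENNReal.ofReal_mul (by positivity), ← ENNReal.ofReal_mul (by positivity)]
      congr 1
      rw [show a - r - 1 = (a - 1) + (-r) by ring, Real.rpow_add h]
      simp only [Real.one_rpow]
      field_simp
  rw [lintegral_congr_ae this, lintegral_const_mul _ (by unfold gammaPDF; fun_prop),
    lintegral_gammaPDF_eq_one (sub_pos.2 hr) one_pos, mul_one]

lemma gammaMeasure_conv_expMeasure (n : ℕ) :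
    (gammaMeasure (n + 1) 1).conv (expMeasure 1) = gammaMeasure (n + 1 + 1) 1 := by
  have : IsProbabilityMeasure (gammaMeasure ((n : ℝ) + 1) 1) :=
    isProbabilityMeasure_gammaMeasure (by positivity) one_pos
  have : IsProbabilityMeasure (expMeasure 1) := isProbabilityMeasure_expMeasure one_pos
  have m1 : Measurable (gammaPDF ((n : ℝ) + 1) 1) := by unfold gammaPDF; fun_prop
  have m3 : Measurable (gammaPDF ((n : ℝ) + 1 + 1) 1) := by unfold gammaPDF; fun_prop
  have m2 : Measurable (gammaPDF 1 1) := by unfold gammaPDF; fun_prop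
  refine Measure.ext_of_lintegral _ fun g hg => ?_
  rw [Measure.lintegral_conv hg, expMeasure, gammaMeasure, gammaMeasure, gammaMeasure,
    lintegral_withDensity_eq_lintegral_mul _ m1 (by fun_prop),
    lintegral_withDensity_eq_lintegral_mul _ m3 hg]
  have h1 : ∀ x : ℝ, ∫⁻ y, g (x + y) ∂(volume.withDensity (gammaPDF 1 1)) =
      ∫⁻ z, gammaPDF 1 1 (z - x) * g z := by
    intro x
    rw [lintegral_withDensity_eq_lintegral_mul _ m2 (by fun_prop),
      ← lintegral_sub_right_eq_self _ x]
    simp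
  simp only [Pi.mul_apply, h1]
  simp_rw [← lintegral_const_mul' _ _ (show gammaPDF _ _ _ ≠ ∞ by simp [gammaPDF])]
  rw [lintegral_lintegral_swap (by fun_prop)]
  congr 1 with z
  have h2 : ∀ x, gammaPDF (n + 1) 1 x * (gammaPDF 1 1 (z - x) * g z) =
      (gammaPDF (n + 1) 1 x * gammaPDF 1 1 (z - x)) * g z := fun x => by ring
  simp_rw [h2]
  rw [lintegral_mul_const _ (by fun_prop)]
  congr 1
  -- The exponentials combine to e^{-z}, free of x, so only the integral of x^n over [0, z] remains.
  have h3 : ∀ x, gammaPDF (n + 1) 1 x * gammaPDF 1 1 (z - x) =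
      (Set.Icc 0 z).indicator
        (fun x => ENNReal.ofReal (x ^ n * (Real.exp (-z) / Real.Gamma (n + 1)))) x := by
    intro x
    by_cases hx : x ∈ Set.Icc 0 z
    · rw [Set.indicator_of_mem hx, gammaPDF_of_nonneg hx.1,
        gammaPDF_of_nonneg (sub_nonneg.2 hx.2), ← ENNReal.ofReal_mul]
      · congr 1
        simp only [Real.one_rpow, add_sub_cancel_right, Real.rpow_natCast, sub_self,
          Real.rpow_zero, Real.Gamma_one, one_mul, mul_one, div_one]
        rw [show -z = -x + -(z - x) by ring, Real.exp_add]
        ring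
      · have := hx.1
        have := Real.Gamma_pos_of_pos (show (0 : ℝ) < n + 1 by positivity)
        positivity
    · rw [Set.indicator_of_notMem hx]
      rw [Set.mem_Icc, not_and_or, not_le, not_le] at hx
      rcases hx with hx | hx
      · rw [gammaPDF_of_neg hx, zero_mul]
      · rw [gammaPDF_of_neg (sub_neg.2 hx), mul_zero]
  simp_rw [h3]
  rw [lintegral_indicator measurableSet_Icc]
  rcases lt_or_ge z 0 with hz | hz
  · rw [Set.Icc_eq_empty (not_le.2 hz), gammaPDF_of_neg hz]; simp
  · have hG := Real.Gamma_pos_of_pos (show (0 : ℝ) < n + 1 by positivity)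
    rw [gammaPDF_of_nonneg hz, ← ofReal_integral_eq_lintegral_ofReal]
    · congr 1
      rw [integral_mul_const, integral_Icc_eq_integral_Ioc,
        ← intervalIntegral.integral_of_le hz, integral_pow,
        Real.Gamma_add_one (show (n : ℝ) + 1 ≠ 0 by positivity)]
      simp only [Real.one_rpow, add_sub_cancel_right, one_mul]
      rw [show ((n : ℝ) + 1) = ((n + 1 : ℕ) : ℝ) by push_cast; ring, Real.rpow_natCast]
      push_cast
      field_simp
      simp
    · exact (Continuous.integrableOn_Icc (by fun_prop))
    · refine (ae_restrict_iff' measurableSet_Icc).2 (Eventually.of_forall fun x hx => ?_)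
      have := hx.1
      simp only [Pi.zero_apply]
      positivity

/-! ### Law and negative moments of the arrival times. -/

section Arrivals

lemma sum_waitingTime {Ω : Type*} (Γ : ℕ → Ω → ℝ) (n : ℕ) :
    ∑ i ∈ Finset.range (n + 1), waitingTime Γ i = Γ n := by
  induction n with
  | zero => simp [waitingTime]
  | succ n ih => rw [Finset.sum_range_succ, ih]; ext ω; simp [waitingTime]

variable {Ω : Type*} [MeasurableSpace Ω] {μ : Measure Ω}

lemma IsPoissonArrivals.measurable_waitingTime {Γ : ℕ → Ω → ℝ} (h : IsPoissonArrivals Γ μ)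
    (n : ℕ) : Measurable (waitingTime Γ n) := by
  cases n with
  | zero => exact h.measurable 0
  | succ n => exact (h.measurable (n + 1)).sub (h.measurable n)

lemma IsPoissonArrivals.map_eq [IsProbabilityMeasure μ] {Γ : ℕ → Ω → ℝ}
    (h : IsPoissonArrivals Γ μ) (n : ℕ) : μ.map (Γ n) = gammaMeasure (n + 1) 1 := by
  induction n with
  | zero => simpa [expMeasure, waitingTime] using (h.law 0).map_eq
  | succ n ih =>
    have hi : IndepFun (Γ n) (waitingTime Γ (n + 1)) μ := by
      rw [← sum_waitingTime Γ n]
      exact h.indep.indepFun_sum_range_succ h.measurable_waitingTime (n + 1)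
    have e : Γ (n + 1) = Γ n + waitingTime Γ (n + 1) := by
      ext ω; simp [waitingTime]
    rw [e, hi.map_add_eq_map_conv_map (h.measurable n) (h.measurable_waitingTime _), ih,
      (h.law (n + 1)).map_eq, gammaMeasure_conv_expMeasure]
    push_cast
    rfl

lemma IsPoissonArrivals.lintegral_rpow_neg_le [IsProbabilityMeasure μ] {Γ : ℕ → Ω → ℝ}
    (h : IsPoissonArrivals Γ μ) {r : ℝ} (hr : 0 < r) :
    ∃ C : ℝ, 0 < C ∧ ∀ n : ℕ, r < n + 1 →
      ∫⁻ ω, ENNReal.ofReal (Γ n ω ^ (-r)) ∂μ ≤ ENNReal.ofReal (C * ((n : ℝ) + 1) ^ (-r)) := by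
  obtain ⟨C, hC, hb⟩ := gamma_ratio_le hr
  refine ⟨C, hC, fun n hn => ?_⟩
  have := lintegral_map (μ := μ) (f := fun x : ℝ => ENNReal.ofReal (x ^ (-r))) (by fun_prop)
    (h.measurable n)
  rw [← this, h.map_eq, lintegral_rpow_neg_gammaMeasure hn (by positivity)]
  exact ENNReal.ofReal_le_ofReal (hb n hn)

lemma IsPoissonArrivals.ae_pos [IsProbabilityMeasure μ] {Γ : ℕ → Ω → ℝ}
    (h : IsPoissonArrivals Γ μ) (n : ℕ) : ∀ᵐ ω ∂μ, 0 < Γ n ω := by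
  refine ae_of_ae_map (p := fun x => 0 < x) (h.measurable n).aemeasurable ?_
  rw [h.map_eq, gammaMeasure, ae_withDensity_iff (by unfold gammaPDF; fun_prop)]
  filter_upwards [Measure.ae_ne volume (0 : ℝ)] with x hx hx'
  by_contra hlt
  exact hx' (gammaPDF_of_neg (lt_of_le_of_ne (not_lt.1 hlt) hx))

end Arrivals

/-! ### Exponential tails of the supremum of a Gaussian process. -/

section GaussianSupremum

-- Fernique's theorem with a constant depending only on c, a and l. Independence of the dimension is
-- what allows a supremum over infinitely many times.
open Fernique in
lemma measure_lt_norm_le_of_map_rotation_eq_self {c : ℝ≥0∞} (hc : 2⁻¹ < c) (hc1 : c < 1)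
    {a : ℝ} (ha : 0 < a) {l : ℝ} (hl : 0 ≤ l) :
    ∃ C : ℝ≥0, ∀ (ι : Type) [Fintype ι] (ν : Measure (ι → ℝ)) [IsProbabilityMeasure ν],
      (ν.prod ν).map (ContinuousLinearMap.rotation (-(Real.pi / 4))) = ν.prod ν →
      c ≤ ν {x | ‖x‖ ≤ a} →
      ∀ y : ℝ, ν {x | y < ‖x‖} ≤ C * ENNReal.ofReal (Real.exp (-(l * y))) := by
  -- Since c > 1/2, the logarithm of c/(1-c) is positive and the series converges.
  have hfin : ENNReal.ofReal (Real.exp (logRatio c)) +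
      ∑' n : ℕ, ENNReal.ofReal (Real.exp (-2⁻¹ * Real.log (c / (1 - c)).toReal * 2 ^ n)) ≠ ∞ := by
    have hc_lt_top : c < ∞ := hc1.trans (by simp)
    have hc_one_sub_lt_top : 1 - c < ∞ := lt_top_of_lt (b := 2) (tsub_le_self.trans_lt (by simp))
    have h_one_sub_lt_self : 1 - c < c := by
      refine ENNReal.sub_lt_of_lt_add hc1.le ?_
      rw [← two_mul]
      rwa [inv_eq_one_div, ENNReal.div_lt_iff (by simp) (by simp), mul_comm] at hc
    refine (ENNReal.add_lt_top.mpr ⟨ENNReal.ofReal_lt_top, ?_⟩).ne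
    refine Summable.tsum_ofReal_lt_top <|
      Real.summable_exp_nat_mul_of_ge ?_ (fun i ↦ mod_cast (Nat.lt_pow_self (by simp)).le)
    refine mul_neg_of_neg_of_pos (by simp) (Real.log_pos ?_)
    simp only [ENNReal.toReal_div, one_lt_div_iff, ENNReal.toReal_pos_iff, tsub_pos_iff_lt, hc1,
      hc_one_sub_lt_top, and_self, true_and]
    rw [ENNReal.toReal_lt_toReal hc_one_sub_lt_top.ne hc_lt_top.ne]
    exact .inl h_one_sub_lt_self
  set K := ENNReal.ofReal (Real.exp (logRatio c)) +
      ∑' n : ℕ, ENNReal.ofReal (Real.exp (-2⁻¹ * Real.log (c / (1 - c)).toReal * 2 ^ n)) with hK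
  set k := logRatio c * a⁻¹ ^ 2 with hk
  have hk0 : 0 < k := mul_pos (logRatio_pos hc hc1) (by positivity)
  -- Completing the square, l‖x‖ ≤ k‖x‖² + l²/(4k): Gaussian integrability gives any exponential
  -- rate.
  refine ⟨Real.toNNReal (Real.exp (l ^ 2 / (4 * k))) * K.toNNReal, fun ι _ ν _ hrot hcν y => ?_⟩
  have hF := lintegral_exp_mul_sq_norm_le_of_map_rotation_eq_self hrot hcν hc
  rw [← hK, ← hk] at hF
  have hpt : ∀ x : ι → ℝ, {x : ι → ℝ | y < ‖x‖}.indicator (fun _ => (1 : ℝ≥0∞)) x ≤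
      ENNReal.ofReal (Real.exp (l ^ 2 / (4 * k)) * Real.exp (-(l * y))) *
        ENNReal.ofReal (Real.exp (k * ‖x‖ ^ 2)) := by
    intro x
    refine Set.indicator_le' (s := {x : ι → ℝ | y < ‖x‖})
      (g := fun x => ENNReal.ofReal (Real.exp (l ^ 2 / (4 * k)) * Real.exp (-(l * y))) *
        ENNReal.ofReal (Real.exp (k * ‖x‖ ^ 2))) (fun x (hx : y < ‖x‖) => ?_) (fun _ _ => zero_le) x
    rw [← ENNReal.ofReal_mul (by positivity), ← Real.exp_add, ← Real.exp_add]
    refine ENNReal.one_le_ofReal.2 (Real.one_le_exp ?_)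
    have h1 : l * y ≤ l * ‖x‖ := by gcongr
    have h2 : l ^ 2 / (4 * k) - l * ‖x‖ + k * ‖x‖ ^ 2 = (l - 2 * k * ‖x‖) ^ 2 / (4 * k) := by
      field_simp; ring
    have h3 : 0 ≤ (l - 2 * k * ‖x‖) ^ 2 / (4 * k) := by positivity
    linarith
  calc ν {x | y < ‖x‖}
      = ∫⁻ x, {x : ι → ℝ | y < ‖x‖}.indicator (fun _ => (1 : ℝ≥0∞)) x ∂ν := by
        rw [lintegral_indicator_const (measurableSet_lt (by fun_prop) (by fun_prop)), one_mul]
    _ ≤ _ := lintegral_mono hpt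
    _ ≤ ENNReal.ofReal (Real.exp (l ^ 2 / (4 * k)) * Real.exp (-(l * y))) * K := by
        rw [lintegral_const_mul' _ _ (by simp)]; gcongr
    _ = _ := by
        rw [ENNReal.ofReal_mul (by positivity), ENNReal.coe_mul, ENNReal.coe_toNNReal hfin,
          ENNReal.ofReal]
        ring

variable {Ω : Type*} [MeasurableSpace Ω] {μ : Measure Ω}

lemma map_rotation_eq_self_of_isGaussianProcess {T : Type*} {B : T → Ω → ℝ}
    (hB : IsGaussianProcess B μ) (h0 : ∀ t, ∫ ω, B t ω ∂μ = 0) (I : Finset T) (θ : ℝ) :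
    ((μ.map fun ω => I.restrict (B · ω)).prod (μ.map fun ω => I.restrict (B · ω))).map
      (ContinuousLinearMap.rotation θ) =
    (μ.map fun ω => I.restrict (B · ω)).prod (μ.map fun ω => I.restrict (B · ω)) := by
  have hI := hB.hasGaussianLaw I
  have := hI.isGaussian_map
  refine IsGaussian.map_rotation_eq_self ?_ θ
  rw [integral_map hI.aemeasurable (by fun_prop)]
  ext i
  exact (eval_integral (fun i : I => (hB.hasGaussianLaw_eval i).integrable) i).trans (h0 i)

lemma measure_exists_lt_abs_le {B : ℝ≥0 → Ω → ℝ} (hB : IsGaussianProcess B μ)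
    (h0 : ∀ t, ∫ ω, B t ω ∂μ = 0) (hcont : ∀ᵐ ω ∂μ, Continuous fun t => B t ω) (T : ℝ≥0)
    {l : ℝ} (hl : 0 ≤ l) :
    ∃ C : ℝ≥0, ∀ y : ℝ,
      μ {ω | ∃ s ≤ T, y < |B s ω|} ≤ C * ENNReal.ofReal (Real.exp (-(l * y))) := by
  classical
  have := hB.isProbabilityMeasure
  have : Nonempty (Set.Iic T) := ⟨⟨T, Set.self_mem_Iic⟩⟩
  set d := TopologicalSpace.denseSeq (Set.Iic T) with hd
  obtain ⟨c, hc, hc1⟩ : ∃ c : ℝ≥0∞, 2⁻¹ < c ∧ c < 1 := exists_between (by simp)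
  set A : ℕ → Set Ω := fun k => {ω | ∀ i, |B (d i) ω| ≤ (k : ℝ) + 1} with hA
  have hAmono : Monotone A := fun k k' hk ω hω i => (hω i).trans (by gcongr)
  have hAfull : μ (⋃ k, A k) = 1 := by
    refine (prob_compl_eq_zero_iff₀ ?_).1 ?_
    · refine NullMeasurableSet.iUnion fun k => ?_
      have : A k = ⋂ i, {ω | |B (d i) ω| ≤ (k : ℝ) + 1} := by ext; simp [hA]
      rw [this]
      refine NullMeasurableSet.iInter fun i => ?_
      exact nullMeasurableSet_le (hB.aemeasurable _).abs aemeasurable_const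
    · rw [← mem_ae_iff]
      filter_upwards [hcont] with ω hω
      obtain ⟨b, hb⟩ := (isCompact_Icc (a := (0 : ℝ≥0)) (b := T)).exists_bound_of_continuousOn
        hω.continuousOn
      obtain ⟨k, hk⟩ := exists_nat_ge b
      refine Set.mem_iUnion.2 ⟨k, fun i => ?_⟩
      have := hb (d i) ⟨zero_le, (d i).2⟩
      rw [Real.norm_eq_abs] at this
      linarith
  -- Continuous paths are bounded on [0, T], so one level k + 1 has probability above c for the
  -- whole dense sequence, hence for all its finite marginals at once.
  obtain ⟨k, hk⟩ : ∃ k, c < μ (A k) := by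
    rw [hAmono.measure_iUnion] at hAfull
    exact lt_iSup_iff.1 (hAfull ▸ hc1)
  obtain ⟨C, hC⟩ := measure_lt_norm_le_of_map_rotation_eq_self hc hc1
    (show (0 : ℝ) < k + 1 by positivity) hl
  refine ⟨C, fun y => ?_⟩
  set S : ℕ → Set Ω := fun n => {ω | ∃ i < n, y < |B (d i) ω|} with hS
  have hSmono : Monotone S := fun n n' hn ω ⟨i, hi, h⟩ => ⟨i, hi.trans_le hn, h⟩
  have hSn : ∀ n, μ (S n) ≤ C * ENNReal.ofReal (Real.exp (-(l * y))) := by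
    intro n
    rcases Nat.eq_zero_or_pos n with rfl | hn
    · simp [hS]
    set I : Finset ℝ≥0 := (Finset.range n).image (fun i => (d i : ℝ≥0)) with hI
    have hdI : ∀ i < n, (d i : ℝ≥0) ∈ I := fun i hi =>
      Finset.mem_image_of_mem _ (Finset.mem_range.2 hi)
    have hIm := (hB.hasGaussianLaw I).aemeasurable
    have := (hB.hasGaussianLaw I).isGaussian_map
    refine le_trans ?_ (hC I (μ.map fun ω => I.restrict (B · ω))
      (map_rotation_eq_self_of_isGaussianProcess hB h0 I _) ?_ y)
    · rw [Measure.map_apply_of_aemeasurable hIm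
        (measurableSet_lt (by fun_prop) (by fun_prop))]
      refine measure_mono fun ω ⟨i, hi, h⟩ => h.trans_le ?_
      exact norm_le_pi_norm (I.restrict (B · ω)) ⟨d i, hdI i hi⟩
    · rw [Measure.map_apply_of_aemeasurable hIm
        (measurableSet_le (by fun_prop) (by fun_prop))]
      refine hk.le.trans (measure_mono fun ω hω => ?_)
      refine (pi_norm_le_iff_of_nonneg (by positivity)).2 fun i => ?_
      obtain ⟨j, -, hj⟩ := Finset.mem_image.1 i.2
      have := hω j
      rw [hj] at this
      exact this
  calc μ {ω | ∃ s ≤ T, y < |B s ω|} ≤ μ (⋃ n, S n) := by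
        refine measure_mono_ae ?_
        filter_upwards [hcont] with ω hω hs
        obtain ⟨s, hsT, hs⟩ := hs
        have hcω : Continuous fun s : Set.Iic T => |B s ω| :=
          (hω.comp continuous_subtype_val).abs
        obtain ⟨i, hi⟩ := (TopologicalSpace.denseRange_denseSeq (Set.Iic T)).exists_mem_open
          (isOpen_lt continuous_const hcω) ⟨⟨s, hsT⟩, hs⟩
        exact Set.mem_iUnion.2 ⟨i + 1, i, Nat.lt_succ_self i, hi⟩
    _ = ⨆ n, μ (S n) := hSmono.measure_iUnion
    _ ≤ _ := iSup_le hSn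

end GaussianSupremum

/-! ### Evaluating a random function at a random point. -/

section Discretization

/-- Rounding down to the grid of mesh `1 / (k + 1)`. -/
noncomputable def gridReal (k : ℕ) (x : ℝ) : ℝ := (⌊((k : ℝ) + 1) * x⌋ : ℝ) / (k + 1)

/-- Rounding down to the grid of mesh `1 / (k + 1)` in `ℝ₊`. -/
noncomputable def gridNNReal (k : ℕ) (t : ℝ≥0) : ℝ≥0 := (⌊((k : ℝ≥0) + 1) * t⌋₊ : ℝ≥0) / (k + 1)

lemma abs_gridReal_sub_le (k : ℕ) (x : ℝ) : |gridReal k x - x| ≤ 1 / ((k : ℝ) + 1) := by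
  have hk : (0 : ℝ) < k + 1 := by positivity
  have h1 := Int.floor_le (((k : ℝ) + 1) * x)
  have h2 := Int.lt_floor_add_one (((k : ℝ) + 1) * x)
  have e : gridReal k x - x = ((⌊((k : ℝ) + 1) * x⌋ : ℝ) - (k + 1) * x) / (k + 1) := by
    unfold gridReal; field_simp
  rw [e, abs_div, abs_of_pos hk]
  gcongr
  rw [abs_le]
  constructor <;> linarith

lemma abs_le_abs_gridReal_add_one (k : ℕ) (x : ℝ) : |x| ≤ |gridReal k x| + 1 := by
  have h1 := abs_gridReal_sub_le k x
  have h2 : 1 / ((k : ℝ) + 1) ≤ 1 := by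
    rw [div_le_one (by positivity)]; linarith [(Nat.cast_nonneg k : (0 : ℝ) ≤ k)]
  have h3 := abs_sub_abs_le_abs_sub x (gridReal k x)
  rw [abs_sub_comm] at h3
  linarith

lemma tendsto_gridReal (x : ℝ) : Tendsto (fun k => gridReal k x) atTop (𝓝 x) := by
  rw [tendsto_iff_dist_tendsto_zero]
  exact squeeze_zero (fun _ => dist_nonneg) (fun k => abs_gridReal_sub_le k x)
    tendsto_one_div_add_atTop_nhds_zero_nat

lemma gridNNReal_le (k : ℕ) (t : ℝ≥0) : gridNNReal k t ≤ t := by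
  unfold gridNNReal
  rw [div_le_iff₀ (by positivity), mul_comm t]
  exact Nat.floor_le zero_le

lemma tendsto_gridNNReal (t : ℝ≥0) : Tendsto (fun k => gridNNReal k t) atTop (𝓝 t) := by
  rw [← NNReal.tendsto_coe]
  refine tendsto_of_tendsto_of_tendsto_of_le_of_le (g := fun k : ℕ => (t : ℝ) - 1 / ((k : ℝ) + 1))
    ?_ tendsto_const_nhds (fun k => ?_) (fun k => NNReal.coe_le_coe.2 (gridNNReal_le k t))
  · simpa using (tendsto_const_nhds (x := (t : ℝ))).sub tendsto_one_div_add_atTop_nhds_zero_nat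
  · have h := Nat.lt_floor_add_one (((k : ℝ≥0) + 1) * t)
    have h' : ((k : ℝ) + 1) * t < (⌊((k : ℝ≥0) + 1) * t⌋₊ : ℝ) + 1 := by exact_mod_cast h
    have e : ((gridNNReal k t : ℝ≥0) : ℝ) = (⌊((k : ℝ≥0) + 1) * t⌋₊ : ℝ) / (k + 1) := by
      unfold gridNNReal; push_cast; rfl
    dsimp only
    rw [e, sub_le_iff_le_add, ← add_div, le_div_iff₀ (by positivity)]
    linarith

/-- The product σ-algebra only sees evaluations at fixed points. A rounded point takes countably
many values, so evaluation there is measurable; limits then recover continuous functions. -/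
lemma measurable_eval_grid {S : Type*} [MeasurableSpace S] (k : ℕ) {ξ : S → ℝ} {τ : S → ℝ≥0}
    {φ : S → ℝ → ℝ≥0 → ℝ} (hξ : Measurable ξ) (hτ : Measurable τ) (hφ : Measurable φ) :
    Measurable fun s => φ s (gridReal k (ξ s)) (gridNNReal k (τ s)) := by
  have hF : Measurable fun z : (ℤ × ℕ) × (ℝ → ℝ≥0 → ℝ) =>
      z.2 ((z.1.1 : ℝ) / (k + 1)) ((z.1.2 : ℝ≥0) / (k + 1)) :=
    by
    refine measurable_from_prod_countable_right fun z => ?_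
    exact (measurable_pi_apply ((z.2 : ℝ≥0) / (k + 1))).comp
      (measurable_pi_apply ((z.1 : ℝ) / (k + 1)))
  have h1 : Measurable fun s => ⌊((k : ℝ) + 1) * ξ s⌋ := by fun_prop
  have h2 : Measurable fun s => ⌊((k : ℝ≥0) + 1) * τ s⌋₊ := by fun_prop
  exact hF.comp ((h1.prodMk h2).prodMk hφ)

/-- The value `φ x t` of a function at a point, as a limit of its values on finer and finer
grids. -/
noncomputable def gridEval (φ : ℝ → ℝ≥0 → ℝ) (x : ℝ) (t : ℝ≥0) : ℝ :=
  limUnder atTop fun k => φ (gridReal k x) (gridNNReal k t)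

lemma tendsto_grid_of_continuous {φ : ℝ → ℝ≥0 → ℝ} (hφ : Continuous fun z : ℝ × ℝ≥0 => φ z.1 z.2)
    (x : ℝ) (t : ℝ≥0) :
    Tendsto (fun k => φ (gridReal k x) (gridNNReal k t)) atTop (𝓝 (φ x t)) :=
  (hφ.tendsto (x, t)).comp ((tendsto_gridReal x).prodMk_nhds (tendsto_gridNNReal t))

lemma gridEval_eq_of_continuous {φ : ℝ → ℝ≥0 → ℝ} (hφ : Continuous fun z : ℝ × ℝ≥0 => φ z.1 z.2)
    (x : ℝ) (t : ℝ≥0) : gridEval φ x t = φ x t :=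
  (tendsto_grid_of_continuous hφ x t).limUnder_eq

lemma measurable_gridEval {S : Type*} [MeasurableSpace S] {ξ : S → ℝ} {τ : S → ℝ≥0}
    {φ : S → ℝ → ℝ≥0 → ℝ} (hξ : Measurable ξ) (hτ : Measurable τ) (hφ : Measurable φ) :
    Measurable fun s => gridEval (φ s) (ξ s) (τ s) :=
  (StronglyMeasurable.limUnder fun k =>
    (measurable_eval_grid k hξ hτ hφ).stronglyMeasurable).measurable

end Discretization

/-! ### Decay of the random functions in space and moments of the shots. -/

section FieldMoments

variable {Ω : Type*} [MeasurableSpace Ω] {μ : Measure Ω} {H ρ : ℝ} {Γ G X : ℕ → Ω → ℝ}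
  {f : ℕ → Ω → ℝ → ℝ≥0 → ℝ} {B : ℕ → ℝ≥0 → Ω → ℝ}

lemma IsModel.lintegral_field_rpow_le [IsProbabilityMeasure μ] (h : IsModel H ρ Γ G X f B μ)
    (T : ℝ≥0) {q : ℝ} (hq : 0 < q) {l : ℝ} (hl : 0 ≤ l) :
    ∃ D : ℝ≥0, ∀ n, ∀ t ≤ T, ∀ x : ℝ,
      ∫⁻ ω, ‖f n ω x t‖ₑ ^ q ∂μ ≤ D * ENNReal.ofReal (Real.exp (-(l * |x|))) := by
  -- The moment 2q and the tail rate 2l anticipate the square roots of Cauchy–Schwarz, applied to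
  -- f^q and the indicator of f ≠ 0.
  obtain ⟨M, hM⟩ := h.field_moments 0 (Set.Icc 0 T) isCompact_Icc (2 * q) (by positivity)
  obtain ⟨C, hC⟩ := measure_exists_lt_abs_le (h.fbm 0).isGaussian (h.fbm 0).centred
    (h.fbm 0).continuous_paths T (l := 2 * l) (by positivity)
  refine ⟨M ^ (1 / 2 : ℝ) * C ^ (1 / 2 : ℝ) * Real.toNNReal (Real.exp (l * (ρ + 1))),
    fun n t ht x => ?_⟩
  have hmeas : ∀ n, Measurable fun ω => f n ω x t := fun n =>
    (measurable_pi_apply t).comp ((measurable_pi_apply x).comp (h.measurable_field n))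
  have hid : ∫⁻ ω, ‖f n ω x t‖ₑ ^ q ∂μ = ∫⁻ ω, ‖f 0 ω x t‖ₑ ^ q ∂μ := by
    have hu : Measurable fun φ : ℝ → ℝ≥0 → ℝ => ‖φ x t‖ₑ ^ q := by fun_prop
    exact ((h.identDistrib_field n).comp hu).lintegral_eq
  rw [hid]
  have hmom : ∫⁻ ω, ‖f 0 ω x t‖ₑ ^ (2 * q) ∂μ ≤ M := by
    refine (lintegral_mono fun ω => ?_).trans (hM x)
    gcongr
    exact le_iSup₂ (f := fun (s : ℝ≥0) (_ : s ∈ Set.Icc 0 T) => ‖f 0 ω x s‖ₑ) t ⟨zero_le, ht⟩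
  -- The loss of 1 makes the inequality strict, so a time s beyond the level exists without the
  -- extremum having to be attained.
  have htail : μ {ω | f 0 ω x t ≠ 0} ≤
      C * ENNReal.ofReal (Real.exp (-(2 * l * (|x| - ρ - 1)))) := by
    refine le_trans (measure_mono_ae ?_) (hC (|x| - ρ - 1))
    filter_upwards [h.field_support 0] with ω hω hne
    have hx := hω t x hne
    have hne' : ((fun s => B 0 s ω) '' Set.Iic t).Nonempty := ⟨_, ⟨t, Set.self_mem_Iic, rfl⟩⟩
    rcases abs_cases x with ⟨hx', -⟩ | ⟨hx', -⟩
    · obtain ⟨_, ⟨s, hs, rfl⟩, hlt⟩ := exists_lt_of_lt_csSup hne'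
        (show |x| - ρ - 1 < _ by rw [hx']; linarith [hx.2])
      exact ⟨s, hs.trans ht, hlt.trans_le (le_abs_self _)⟩
    · obtain ⟨_, ⟨s, hs, rfl⟩, hlt⟩ := exists_lt_of_csInf_lt hne'
        (show _ < -(|x| - ρ - 1) by rw [hx']; linarith [hx.1])
      dsimp only at hlt
      exact ⟨s, hs.trans ht, (by linarith : |x| - ρ - 1 < -B 0 s ω).trans_le (neg_le_abs _)⟩
  have hset : MeasurableSet {ω | f 0 ω x t ≠ 0} := (hmeas 0) (measurableSet_singleton 0).compl
  have hcs := ENNReal.lintegral_mul_le_Lp_mul_Lq μ Real.HolderConjugate.two_two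
    (f := fun ω => ‖f 0 ω x t‖ₑ ^ q) (g := {ω | f 0 ω x t ≠ 0}.indicator 1)
    ((hmeas 0).enorm.pow_const q).aemeasurable (measurable_one.indicator hset).aemeasurable
  have e0 : ∀ ω, ((fun ω => ‖f 0 ω x t‖ₑ ^ q) *
      ({ω | f 0 ω x t ≠ 0}.indicator 1 : Ω → ℝ≥0∞)) ω =
      ‖f 0 ω x t‖ₑ ^ q := by
    intro ω
    by_cases h0 : f 0 ω x t = 0
    · simp [h0, hq]
    · simp [h0]
  have e1 : ∀ ω, (‖f 0 ω x t‖ₑ ^ q) ^ (2 : ℝ) = ‖f 0 ω x t‖ₑ ^ (2 * q) := fun ω => by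
    rw [← ENNReal.rpow_mul, mul_comm]
  have e2 : ∀ ω, ({ω | f 0 ω x t ≠ 0}.indicator 1 ω : ℝ≥0∞) ^ (2 : ℝ) =
      {ω | f 0 ω x t ≠ 0}.indicator 1 ω := by
    intro ω
    by_cases h0 : f 0 ω x t = 0 <;> simp [h0]
  simp_rw [e0, e1, e2] at hcs
  rw [lintegral_indicator_one hset] at hcs
  have e3 : (ENNReal.ofReal (Real.exp (-(2 * l * (|x| - ρ - 1))))) ^ (1 / 2 : ℝ) =
      ENNReal.ofReal (Real.exp (l * (ρ + 1))) * ENNReal.ofReal (Real.exp (-(l * |x|))) := by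
    rw [ENNReal.ofReal_rpow_of_pos (by positivity), ← Real.exp_mul,
      ← ENNReal.ofReal_mul (by positivity), ← Real.exp_add]
    congr 2; ring
  calc _ ≤ _ := hcs
    _ ≤ (M : ℝ≥0∞) ^ (1 / 2 : ℝ) *
        (C * ENNReal.ofReal (Real.exp (-(2 * l * (|x| - ρ - 1))))) ^ (1 / 2 : ℝ) := by gcongr
    _ = _ := by
      rw [ENNReal.mul_rpow_of_nonneg _ _ (by norm_num), e3]
      rw [ENNReal.coe_mul, ENNReal.coe_mul, ENNReal.coe_rpow_of_nonneg _ (by norm_num),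
        ENNReal.coe_rpow_of_nonneg _ (by norm_num)]
      simp only [ENNReal.ofReal]
      ring

lemma IsModel.indepFun_laplace_field (h : IsModel H ρ Γ G X f B μ) (n : ℕ) :
    IndepFun (X n) (f n) μ :=
  (IndepFun_iff_Indep _ _ _).2
    (h.indep.indep (show Source.laplace n ≠ Source.field n by simp))

/-- The shot `e^{2|X_n|/α} f_n(X_n, t)`, with the random function evaluated through grids. -/
noncomputable def shot {Ω : Type*} (α : ℝ) (X : ℕ → Ω → ℝ) (f : ℕ → Ω → ℝ → ℝ≥0 → ℝ) (n : ℕ) (ω : Ω) (t : ℝ≥0) : ℝ :=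
  Real.exp (2 * |X n ω| / α) * gridEval (f n ω) (X n ω) t

lemma IsModel.lintegral_shot_rpow_le [IsProbabilityMeasure μ] (h : IsModel H ρ Γ G X f B μ)
    {α : ℝ} (hα : 0 < α) (T : ℝ≥0) {q : ℝ} (hq : 0 < q) :
    ∃ D : ℝ≥0, ∀ n, ∀ t ≤ T, ∫⁻ ω, ‖shot α X f n ω t‖ₑ ^ q ∂μ ≤ D := by
  -- This decay rate exactly cancels the factor e^{2q|x|/α}, so the bound is uniform in x.
  set l := 2 * q / α with hl
  have hl0 : 0 ≤ l := by positivity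
  obtain ⟨D, hD⟩ := h.lintegral_field_rpow_le T hq hl0
  refine ⟨D * Real.toNNReal (Real.exp l), fun n t ht => ?_⟩
  have hX := h.measurable_laplace n
  have hf := h.measurable_field n
  -- Fubini is used at grid points, where measurability holds; Fatou passes to the limit below.
  -- Rounding moves x by at most 1, which costs the factor e^l.
  have hk : ∀ k, ∫⁻ ω, ENNReal.ofReal (Real.exp (l * |X n ω|)) *
      ‖f n ω (gridReal k (X n ω)) (gridNNReal k t)‖ₑ ^ q ∂μ ≤
      D * ENNReal.ofReal (Real.exp l) := by
    intro k
    have hF : Measurable fun z : ℝ × (ℝ → ℝ≥0 → ℝ) => ENNReal.ofReal (Real.exp (l * |z.1|)) *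
        ‖z.2 (gridReal k z.1) (gridNNReal k t)‖ₑ ^ q := by
      have := measurable_eval_grid k (measurable_fst (α := ℝ) (β := ℝ → ℝ≥0 → ℝ))
        (measurable_const (a := t)) measurable_snd
      fun_prop
    have := lintegral_map (μ := μ) hF (hX.prodMk hf)
    dsimp only at this
    rw [← this, (h.indepFun_laplace_field n).map_prod_eq_prod_map_map hX.aemeasurable
      hf.aemeasurable]
    have : IsProbabilityMeasure (μ.map (X n)) := Measure.isProbabilityMeasure_map hX.aemeasurable
    have : IsProbabilityMeasure (μ.map (f n)) := Measure.isProbabilityMeasure_map hf.aemeasurable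
    rw [lintegral_prod _ hF.aemeasurable]
    calc _ ≤ ∫⁻ x, D * ENNReal.ofReal (Real.exp l) ∂(μ.map (X n)) := by
          refine lintegral_mono fun x => ?_
          dsimp only
          rw [lintegral_const_mul' _ _ (by simp),
            lintegral_map (by fun_prop) hf]
          calc _ ≤ ENNReal.ofReal (Real.exp (l * |x|)) *
                (D * ENNReal.ofReal (Real.exp (-(l * |gridReal k x|)))) := by
                gcongr
                exact hD n _ ((gridNNReal_le k t).trans ht) _
            _ = D * ENNReal.ofReal (Real.exp (l * |x| + -(l * |gridReal k x|))) := by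
                rw [Real.exp_add, ENNReal.ofReal_mul (by positivity)]; ring
            _ ≤ _ := by
                gcongr
                nlinarith [abs_le_abs_gridReal_add_one k x]
      _ = _ := by simp
  have hlim : ∀ᵐ ω ∂μ, Tendsto (fun k => ENNReal.ofReal (Real.exp (l * |X n ω|)) *
      ‖f n ω (gridReal k (X n ω)) (gridNNReal k t)‖ₑ ^ q) atTop
      (𝓝 (‖shot α X f n ω t‖ₑ ^ q)) := by
    filter_upwards [h.field_continuous n] with ω hω
    have e : ‖shot α X f n ω t‖ₑ ^ q =
        ENNReal.ofReal (Real.exp (l * |X n ω|)) * ‖f n ω (X n ω) t‖ₑ ^ q := by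
      rw [shot, gridEval_eq_of_continuous hω, enorm_mul, ENNReal.mul_rpow_of_nonneg _ _ hq.le,
        Real.enorm_of_nonneg (by positivity), ENNReal.ofReal_rpow_of_pos (by positivity),
        ← Real.exp_mul]
      congr 3
      rw [hl]; ring
    rw [e]
    refine ENNReal.Tendsto.const_mul ?_ (Or.inr (by simp))
    exact ((ENNReal.continuous_rpow_const.tendsto _).comp
      (tendsto_grid_of_continuous hω (X n ω) t).enorm)
  calc ∫⁻ ω, ‖shot α X f n ω t‖ₑ ^ q ∂μ
      = ∫⁻ ω, liminf (fun k => ENNReal.ofReal (Real.exp (l * |X n ω|)) *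
          ‖f n ω (gridReal k (X n ω)) (gridNNReal k t)‖ₑ ^ q) atTop ∂μ :=
        lintegral_congr_ae (hlim.mono fun ω hω => hω.liminf_eq.symm)
    _ ≤ _ := lintegral_liminf_le fun k => by
        exact ((hX.abs.const_mul l).exp.ennreal_ofReal).mul
          ((measurable_eval_grid k hX (measurable_const (a := t)) hf).enorm.pow_const q)
    _ ≤ D * ENNReal.ofReal (Real.exp l) := by
        refine (liminf_le_liminf (Eventually.of_forall hk)).trans_eq ?_
        exact liminf_const _
    _ = _ := by rw [ENNReal.coe_mul]; rfl

end FieldMoments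

/-! ### Moments of Gaussian sums with independent random coefficients. -/

section GaussianSums

variable {Ω : Type*} [MeasurableSpace Ω] {μ : Measure Ω}

lemma lintegral_enorm_rpow_gaussianReal (v : ℝ≥0) {q : ℝ} (hq : 0 ≤ q) :
    ∫⁻ x, ‖x‖ₑ ^ q ∂(gaussianReal 0 v) =
      (∫⁻ x, ‖x‖ₑ ^ q ∂(gaussianReal 0 1)) * (v : ℝ≥0∞) ^ (q / 2) := by
  have h : gaussianReal 0 v = (gaussianReal 0 1).map (√(v : ℝ) * ·) := by
    rw [gaussianReal_map_const_mul, mul_zero, mul_one]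
    congr 1
    ext
    simp
  rw [h, lintegral_map (by fun_prop) (by fun_prop)]
  simp_rw [enorm_mul, ENNReal.mul_rpow_of_nonneg _ _ hq]
  rw [lintegral_const_mul' _ _ (by simp [ENNReal.rpow_eq_top_iff, hq.not_gt]), mul_comm]
  congr 1
  rw [Real.enorm_of_nonneg (Real.sqrt_nonneg _), Real.sqrt_eq_rpow,
    ← ENNReal.ofReal_rpow_of_nonneg v.coe_nonneg (by norm_num), ENNReal.ofReal_coe_nnreal,
    ← ENNReal.rpow_mul]
  congr 1
  ring

lemma lintegral_enorm_rpow_gaussianReal_ne_top {q : ℝ} (hq : 0 < q) :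
    ∫⁻ x, ‖x‖ₑ ^ q ∂(gaussianReal 0 1) ≠ ∞ := by
  have h := (memLp_id_gaussianReal' (μ := 0) (v := 1) (ENNReal.ofReal q) (by simp)).2
  rw [eLpNorm_lt_top_iff_lintegral_rpow_enorm_lt_top (by simpa using hq) (by simp)] at h
  simpa [hq.le] using h.ne

lemma map_sum_mul_gaussian [IsProbabilityMeasure μ] {G : ℕ → Ω → ℝ} (hG : ∀ n, Measurable (G n))
    (hlaw : ∀ n, HasLaw (G n) (gaussianReal 0 1) μ) (hindep : iIndepFun G μ) (a : ℕ → ℝ)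
    (s : Finset ℕ) :
    μ.map (fun ω => ∑ i ∈ s, a i * G i ω) =
      gaussianReal 0 (∑ i ∈ s, NNReal.mk (a i ^ 2) (sq_nonneg _)) := by
  classical
  induction s using Finset.induction_on with
  | empty => simp [gaussianReal_zero_var]
  | insert j s hj ih =>
    have hi : iIndepFun (fun i ω => a i * G i ω) μ :=
      hindep.comp (fun i x => a i * x) (fun i => by fun_prop)
    have h1 := (hi.indepFun_finsetSum_of_notMem (fun i => (hG i).const_mul _) hj).symm
    have h2 := (gaussianReal_const_mul (hlaw j) (a j)).map_eq
    rw [mul_zero, mul_one] at h2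
    have e : (∑ i ∈ s, fun ω => a i * G i ω) = fun ω => ∑ i ∈ s, a i * G i ω := by
      ext ω; simp
    rw [e] at h1
    have h3 := gaussianReal_add_gaussianReal_of_indepFun h1 h2 ih
    rw [add_zero] at h3
    rw [Finset.sum_insert hj, ← h3]
    congr 1
    ext ω
    simp [Finset.sum_insert hj]

/-- By Fubini the coefficients may be frozen; the sum is then Gaussian, and scaling gives its moment
exactly. -/
lemma lintegral_enorm_sum_mul_gaussian_rpow [IsProbabilityMeasure μ] {G c : ℕ → Ω → ℝ}
    (hG : ∀ n, Measurable (G n)) (hlaw : ∀ n, HasLaw (G n) (gaussianReal 0 1) μ)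
    (hindep : iIndepFun G μ) (hc : ∀ n, Measurable (c n))
    (hcG : IndepFun (fun ω n => c n ω) (fun ω n => G n ω) μ) (s : Finset ℕ) {q : ℝ} (hq : 0 ≤ q) :
    ∫⁻ ω, ‖∑ i ∈ s, c i ω * G i ω‖ₑ ^ q ∂μ =
      (∫⁻ x, ‖x‖ₑ ^ q ∂(gaussianReal 0 1)) *
        ∫⁻ ω, (∑ i ∈ s, ‖c i ω‖ₑ ^ (2 : ℝ)) ^ (q / 2) ∂μ := by
  have hc' : Measurable fun ω n => c n ω := measurable_pi_lambda _ hc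
  have hG' : Measurable fun ω n => G n ω := measurable_pi_lambda _ hG
  have hF : Measurable fun z : (ℕ → ℝ) × (ℕ → ℝ) => ‖∑ i ∈ s, z.1 i * z.2 i‖ₑ ^ q := by fun_prop
  have : IsProbabilityMeasure (μ.map fun ω n => c n ω) :=
    Measure.isProbabilityMeasure_map hc'.aemeasurable
  have : IsProbabilityMeasure (μ.map fun ω n => G n ω) :=
    Measure.isProbabilityMeasure_map hG'.aemeasurable
  have h1 := lintegral_map (μ := μ) hF (hc'.prodMk hG')
  dsimp only at h1
  rw [← h1, hcG.map_prod_eq_prod_map_map hc'.aemeasurable hG'.aemeasurable,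
    lintegral_prod _ hF.aemeasurable]
  have h2 : ∀ a : ℕ → ℝ, ∫⁻ g, ‖∑ i ∈ s, a i * g i‖ₑ ^ q ∂(μ.map fun ω n => G n ω) =
      (∫⁻ x, ‖x‖ₑ ^ q ∂(gaussianReal 0 1)) * (∑ i ∈ s, ‖a i‖ₑ ^ (2 : ℝ)) ^ (q / 2) := by
    intro a
    rw [lintegral_map (by fun_prop) hG']
    have h3 := lintegral_map (μ := μ) (f := fun x : ℝ => ‖x‖ₑ ^ q) (by fun_prop)
      (show Measurable fun ω => ∑ i ∈ s, a i * G i ω by fun_prop)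
    rw [← h3, map_sum_mul_gaussian hG hlaw hindep, lintegral_enorm_rpow_gaussianReal _ hq]
    congr 2
    rw [ENNReal.ofNNReal_finsetSum]
    refine Finset.sum_congr rfl fun i _ => ?_
    rw [← ENNReal.ofReal_coe_nnreal, NNReal.coe_mk, ← sq_abs, ← Real.norm_eq_abs,
      ENNReal.ofReal_pow (norm_nonneg _), ofReal_norm]
    norm_cast
  simp_rw [h2]
  rw [lintegral_const_mul _ (by fun_prop), lintegral_map (by fun_prop) hc']

lemma lintegral_finsetSum_rpow_le {ι : Type*} {c : ι → Ω → ℝ≥0∞} (hc : ∀ n, Measurable (c n))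
    (s : Finset ι) {p : ℝ} (hp : 1 ≤ p) :
    (∫⁻ ω, (∑ i ∈ s, c i ω) ^ p ∂μ) ^ (1 / p) ≤ ∑ i ∈ s, (∫⁻ ω, c i ω ^ p ∂μ) ^ (1 / p) := by
  classical
  have hp0 : 0 < p := by linarith
  induction s using Finset.induction_on with
  | empty => simp [hp0]
  | insert j s hj ih =>
    simp_rw [Finset.sum_insert hj]
    refine le_trans ?_ (add_le_add le_rfl ih)
    exact ENNReal.lintegral_Lp_add_le (f := c j) (g := fun ω => ∑ i ∈ s, c i ω)
      (hc j).aemeasurable (by fun_prop) hp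

end GaussianSums

/-! ### Independence of groups of sources and moments of blocks of the series. -/

section Model

variable {Ω : Type*} {α : ℝ} {Γ G X : ℕ → Ω → ℝ} {f : ℕ → Ω → ℝ → ℝ≥0 → ℝ}

/-- The σ-algebra generated by a set of sources of randomness. -/
@[reducible]
def sourcesSigma (Γ G X : ℕ → Ω → ℝ) (f : ℕ → Ω → ℝ → ℝ≥0 → ℝ) (S : Set Source) :
    MeasurableSpace Ω :=
  ⨆ s ∈ S, sourceSigma Γ G X f s

/-- The coefficient `Γ_n^{-1/α} e^{2|X_n|/α} f_n(X_n, t)` of `G_n` in the series. -/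
noncomputable def weight (α : ℝ) (Γ X : ℕ → Ω → ℝ) (f : ℕ → Ω → ℝ → ℝ≥0 → ℝ)
    (n : ℕ) (ω : Ω) (t : ℝ≥0) : ℝ :=
  Γ n ω ^ (-1 / α) * shot α X f n ω t

lemma measurable_arrival_sourcesSigma {S : Set Source} (h : Source.arrivals ∈ S) (n : ℕ) :
    Measurable[sourcesSigma Γ G X f S] (Γ n) :=
  (comap_measurable (Γ n)).mono
    ((le_iSup (fun n => MeasurableSpace.comap (Γ n) inferInstance) n).trans
      (le_iSup₂ (f := fun s (_ : s ∈ S) => sourceSigma Γ G X f s) _ h)) le_rfl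

lemma measurable_gaussian_sourcesSigma {S : Set Source} {n : ℕ} (h : Source.gaussian n ∈ S) :
    Measurable[sourcesSigma Γ G X f S] (G n) :=
  (comap_measurable (G n)).mono
    (le_iSup₂ (f := fun s (_ : s ∈ S) => sourceSigma Γ G X f s) _ h) le_rfl

lemma measurable_laplace_sourcesSigma {S : Set Source} {n : ℕ} (h : Source.laplace n ∈ S) :
    Measurable[sourcesSigma Γ G X f S] (X n) :=
  (comap_measurable (X n)).mono
    (le_iSup₂ (f := fun s (_ : s ∈ S) => sourceSigma Γ G X f s) _ h) le_rfl

lemma measurable_field_sourcesSigma {S : Set Source} {n : ℕ} (h : Source.field n ∈ S) :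
    Measurable[sourcesSigma Γ G X f S] (f n) :=
  (comap_measurable (f n)).mono
    (le_iSup₂ (f := fun s (_ : s ∈ S) => sourceSigma Γ G X f s) _ h) le_rfl

/-- Grid evaluation makes the shot measurable for its own two sources, not merely almost everywhere
equal to such a variable. Independence and adaptedness rest on this. -/
lemma measurable_shot_sourcesSigma {S : Set Source} {n : ℕ} (hX : Source.laplace n ∈ S)
    (hf : Source.field n ∈ S) (t : ℝ≥0) :
    Measurable[sourcesSigma Γ G X f S] fun ω => shot α X f n ω t := by
  let _ := sourcesSigma Γ G X f S
  have h1 : Measurable (X n) := measurable_laplace_sourcesSigma hX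
  have h2 : Measurable (f n) := measurable_field_sourcesSigma hf
  have h3 := measurable_gridEval h1 (measurable_const (a := t)) h2
  exact ((h1.abs.const_mul 2).div_const α).exp.mul h3

lemma measurable_weight_sourcesSigma {S : Set Source} {n : ℕ} (hΓ : Source.arrivals ∈ S)
    (hX : Source.laplace n ∈ S) (hf : Source.field n ∈ S) (t : ℝ≥0) :
    Measurable[sourcesSigma Γ G X f S] fun ω => weight α Γ X f n ω t := by
  let _ := sourcesSigma Γ G X f S
  have h1 : Measurable (Γ n) := measurable_arrival_sourcesSigma hΓ n
  have h2 : Measurable fun ω => shot α X f n ω t := measurable_shot_sourcesSigma hX hf t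
  exact (h1.pow_const _).mul h2

variable [MeasurableSpace Ω] {μ : Measure Ω} {H ρ : ℝ} {B : ℕ → ℝ≥0 → Ω → ℝ}

lemma IsModel.sourceSigma_le (h : IsModel H ρ Γ G X f B μ) (s : Source) :
    sourceSigma Γ G X f s ≤ ‹MeasurableSpace Ω› := by
  cases s with
  | arrivals => exact iSup_le fun n => (h.arrivals.measurable n).comap_le
  | gaussian n => exact (h.measurable_gaussian n).comap_le
  | laplace n => exact (h.measurable_laplace n).comap_le
  | field n => exact (h.measurable_field n).comap_le

lemma IsModel.sourcesSigma_le (h : IsModel H ρ Γ G X f B μ) (S : Set Source) :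
    sourcesSigma Γ G X f S ≤ ‹MeasurableSpace Ω› :=
  iSup₂_le fun s _ => h.sourceSigma_le s

lemma IsModel.indep_sourcesSigma (h : IsModel H ρ Γ G X f B μ) {S S' : Set Source}
    (hS : Disjoint S S') : Indep (sourcesSigma Γ G X f S) (sourcesSigma Γ G X f S') μ :=
  indep_iSup_of_disjoint h.sourceSigma_le h.indep hS

lemma IsModel.indepFun_of_measurable (h : IsModel H ρ Γ G X f B μ) {S S' : Set Source}
    (hS : Disjoint S S') {β γ : Type*} [MeasurableSpace β] [MeasurableSpace γ]
    {U : Ω → β} {V : Ω → γ} (hU : Measurable[sourcesSigma Γ G X f S] U)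
    (hV : Measurable[sourcesSigma Γ G X f S'] V) : IndepFun U V μ :=
  (IndepFun_iff_Indep _ _ _).2
    (indep_of_indep_of_le (h.indep_sourcesSigma hS) hU.comap_le hV.comap_le)

lemma IsModel.measurable_shot (h : IsModel H ρ Γ G X f B μ) (n : ℕ) (t : ℝ≥0) :
    Measurable fun ω => shot α X f n ω t :=
  (measurable_shot_sourcesSigma (Set.mem_univ _) (Set.mem_univ _) t).mono
    (h.sourcesSigma_le Set.univ) le_rfl

lemma IsModel.measurable_weight (h : IsModel H ρ Γ G X f B μ) (n : ℕ) (t : ℝ≥0) :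
    Measurable fun ω => weight α Γ X f n ω t :=
  (measurable_weight_sourcesSigma (Set.mem_univ _) (Set.mem_univ _) (Set.mem_univ _) t).mono
    (h.sourcesSigma_le Set.univ) le_rfl

lemma IsModel.iIndepFun_gaussian (h : IsModel H ρ Γ G X f B μ) : iIndepFun G μ :=
  (iIndepFun_iff_iIndep _ _ _).2
    (h.indep.precomp (g := Source.gaussian) fun _ _ e => by simpa using e)

lemma IsModel.indepFun_weight_gaussian (h : IsModel H ρ Γ G X f B μ) (t : ℝ≥0) :
    IndepFun (fun ω n => weight α Γ X f n ω t) (fun ω n => G n ω) μ := by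
  refine h.indepFun_of_measurable (S := (Set.range Source.gaussian)ᶜ)
    (S' := Set.range Source.gaussian) disjoint_compl_left ?_ ?_
  · refine @measurable_pi_lambda _ _ _ (_) _ _ fun n => ?_
    exact measurable_weight_sourcesSigma (by simp) (by simp) (by simp) t
  · refine @measurable_pi_lambda _ _ _ (_) _ _ fun n => ?_
    exact measurable_gaussian_sourcesSigma ⟨n, rfl⟩

/-- `Γ n` has shape n + 1, so q/α < n + 1 is the finiteness condition for its moment of order -q/α.
-/
lemma IsModel.lintegral_weight_rpow_le [IsProbabilityMeasure μ] (h : IsModel H ρ Γ G X f B μ)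
    (hα : 0 < α) (T : ℝ≥0) {q : ℝ} (hq : 0 < q) :
    ∃ E : ℝ, 0 ≤ E ∧ ∀ n : ℕ, q / α < n + 1 → ∀ t ≤ T,
      ∫⁻ ω, ‖weight α Γ X f n ω t‖ₑ ^ q ∂μ ≤
        ENNReal.ofReal (E * ((n : ℝ) + 1) ^ (-(q / α))) := by
  obtain ⟨D, hD⟩ := h.lintegral_shot_rpow_le hα T hq
  obtain ⟨A, hA0, hA⟩ := h.arrivals.lintegral_rpow_neg_le (div_pos hq hα)
  refine ⟨A * D, by positivity, fun n hn t ht => ?_⟩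
  have hind : IndepFun (fun ω => ‖Γ n ω ^ (-1 / α)‖ₑ ^ q)
      (fun ω => ‖shot α X f n ω t‖ₑ ^ q) μ := by
    have h0 : IndepFun (Γ n) (fun ω => shot α X f n ω t) μ :=
      h.indepFun_of_measurable (S := {Source.arrivals}) (S' := {Source.laplace n, Source.field n})
        (by simp) (measurable_arrival_sourcesSigma (by simp) n)
        (measurable_shot_sourcesSigma (by simp) (by simp) t)
    exact h0.comp (φ := fun x : ℝ => ‖x ^ (-1 / α)‖ₑ ^ q) (ψ := fun x : ℝ => ‖x‖ₑ ^ q)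
      (by fun_prop) (by fun_prop)
  have hΓ := h.arrivals.measurable n
  have hs := h.measurable_shot (α := α) n t
  simp_rw [weight, enorm_mul, ENNReal.mul_rpow_of_nonneg _ _ hq.le]
  have hmul := lintegral_mul_eq_lintegral_mul_lintegral_of_indepFun
    (show Measurable fun ω => ‖Γ n ω ^ (-1 / α)‖ₑ ^ q by fun_prop)
    (show Measurable fun ω => ‖shot α X f n ω t‖ₑ ^ q by fun_prop) hind
  simp only [Pi.mul_apply] at hmul
  rw [hmul]
  have hpow : ∫⁻ ω, ‖Γ n ω ^ (-1 / α)‖ₑ ^ q ∂μ = ∫⁻ ω, ENNReal.ofReal (Γ n ω ^ (-(q / α))) ∂μ := by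
    refine lintegral_congr_ae ?_
    filter_upwards [h.arrivals.ae_pos n] with ω hω
    rw [Real.enorm_of_nonneg (by positivity), ENNReal.ofReal_rpow_of_pos (by positivity),
      ← Real.rpow_mul hω.le]
    congr 2; ring
  rw [hpow]
  calc _ ≤ ENNReal.ofReal (A * ((n : ℝ) + 1) ^ (-(q / α))) * D :=
        mul_le_mul' (hA n hn) (hD n t ht)
    _ = _ := by
        rw [← ENNReal.ofReal_coe_nnreal, ← ENNReal.ofReal_mul (by positivity)]
        congr 1; ring

lemma IsModel.lintegral_sum_Ico_rpow_le [IsProbabilityMeasure μ] (h : IsModel H ρ Γ G X f B μ)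
    (hα : 0 < α) (hα2 : α < 2) (T : ℝ≥0) {q : ℝ} (hq : 2 ≤ q) :
    ∃ C : ℝ, 0 ≤ C ∧ ∀ P N : ℕ, 1 ≤ P → q < ((P : ℝ) + 1) * α → ∀ t ≤ T,
      ∫⁻ ω, ‖∑ i ∈ Finset.Ico P N, weight α Γ X f i ω t * G i ω‖ₑ ^ q ∂μ ≤
        ENNReal.ofReal (C / (P : ℝ) ^ (q * ((2 - α) / (2 * α)))) := by
  have hq0 : 0 < q := by linarith
  obtain ⟨E, hE0, hE⟩ := h.lintegral_weight_rpow_le hα T hq0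
  set κ := ∫⁻ x, ‖x‖ₑ ^ q ∂(gaussianReal 0 1) with hκ
  have hκt : κ ≠ ∞ := lintegral_enorm_rpow_gaussianReal_ne_top hq0
  have hs : 1 < 2 / α := by rw [lt_div_iff₀ hα]; linarith
  have hs0 : 0 < 2 / α - 1 := by linarith
  refine ⟨κ.toReal * (E ^ (2 / q) / (2 / α - 1)) ^ (q / 2), by positivity,
    fun P N hP hPq t ht => ?_⟩
  have hP0 : (0 : ℝ) < P := by exact_mod_cast hP
  have hterm : ∀ i ∈ Finset.Ico P N, (∫⁻ ω, (‖weight α Γ X f i ω t‖ₑ ^ (2 : ℝ)) ^ (q / 2) ∂μ) ^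
      (1 / (q / 2)) ≤ ENNReal.ofReal (E ^ (2 / q) * ((i : ℝ) + 1) ^ (-(2 / α))) := by
    intro i hi
    have hPi : (P : ℝ) ≤ i := by exact_mod_cast (Finset.mem_Ico.1 hi).1
    have h1 : q / α < i + 1 := by
      rw [div_lt_iff₀ hα]; exact hPq.trans_le (by gcongr)
    simp_rw [← ENNReal.rpow_mul, mul_div_cancel₀ q (two_ne_zero' ℝ)]
    calc _ ≤ (ENNReal.ofReal (E * ((i : ℝ) + 1) ^ (-(q / α)))) ^ (1 / (q / 2)) := by
          gcongr
          exact hE i h1 t ht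
      _ = _ := by
          rw [ENNReal.ofReal_rpow_of_nonneg (by positivity) (by positivity),
            Real.mul_rpow hE0 (by positivity), ← Real.rpow_mul (by positivity)]
          congr 3 <;> field_simp
  -- Minkowski needs exponent q/2 ≥ 1, hence q ≥ 2.
  have hmink := lintegral_finsetSum_rpow_le (μ := μ)
    (c := fun i ω => ‖weight α Γ X f i ω t‖ₑ ^ (2 : ℝ))
    (fun i => (h.measurable_weight i t).enorm.pow_const _) (Finset.Ico P N)
    (p := q / 2) (by linarith)
  have hsum := hmink.trans (Finset.sum_le_sum hterm)
  rw [← ENNReal.ofReal_sum_of_nonneg (fun i _ => by positivity), ← Finset.mul_sum] at hsum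
  have hb : E ^ (2 / q) * ∑ i ∈ Finset.Ico P N, ((i : ℝ) + 1) ^ (-(2 / α)) ≤
      E ^ (2 / q) / (2 / α - 1) * (P : ℝ) ^ (1 - 2 / α) := by
    calc _ ≤ E ^ (2 / q) * ((P : ℝ) ^ (1 - 2 / α) / (2 / α - 1)) := by
          gcongr
          exact sum_Ico_rpow_neg_le hs hP
      _ = _ := by ring
  have hsum2 := ENNReal.rpow_le_rpow (hsum.trans (ENNReal.ofReal_le_ofReal hb))
    (show 0 ≤ q / 2 by positivity)
  rw [← ENNReal.rpow_mul, one_div_mul_cancel (by positivity), ENNReal.rpow_one,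
    ENNReal.ofReal_rpow_of_nonneg (by positivity) (by positivity)] at hsum2
  rw [lintegral_enorm_sum_mul_gaussian_rpow h.measurable_gaussian h.law_gaussian
    h.iIndepFun_gaussian (fun n => h.measurable_weight n t) (h.indepFun_weight_gaussian t) _ hq0.le]
  calc _ ≤ _ := mul_le_mul' le_rfl hsum2
    _ = _ := by
      rw [mul_div_assoc, ENNReal.ofReal_mul ENNReal.toReal_nonneg, ENNReal.ofReal_toReal hκt]
      congr 2
      rw [Real.mul_rpow (by positivity) (by positivity), ← Real.rpow_mul hP0.le,
        div_eq_mul_inv _ ((P : ℝ) ^ _), ← Real.rpow_neg hP0.le]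
      -- The exponents agree: (q/2)(1 - 2/α) = -q(2-α)/(2α).
      congr 2
      field_simp
      ring

end Model

/-! ### Almost sure convergence by martingales. -/

section Convergence

variable {Ω : Type*} [MeasurableSpace Ω] {μ : Measure Ω} {H ρ α : ℝ} {Γ G X : ℕ → Ω → ℝ}
  {f : ℕ → Ω → ℝ → ℝ≥0 → ℝ} {B : ℕ → ℝ≥0 → Ω → ℝ}

/-- The filtration of the partial sums from index `P` on, conditionally on all the coefficients. -/
def IsModel.gaussianFiltration (h : IsModel H ρ Γ G X f B μ) (P : ℕ) :
    Filtration ℕ ‹MeasurableSpace Ω› where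
  seq n := sourcesSigma Γ G X f {s | ∀ i, s = Source.gaussian i → i < P + n}
  mono' := fun _ _ hnm => biSup_mono fun _ hs i hi => (hs i hi).trans_le (by gcongr)
  le' _ := h.sourcesSigma_le _

lemma IsModel.integral_gaussian (h : IsModel H ρ Γ G X f B μ) (n : ℕ) :
    Integrable (G n) μ ∧ ∫ ω, G n ω ∂μ = 0 := by
  have hG := (h.measurable_gaussian n).aemeasurable (μ := μ)
  constructor
  · have h1 : Integrable id (μ.map (G n)) := by
      rw [(h.law_gaussian n).map_eq, ← memLp_one_iff_integrable]
      exact memLp_id_gaussianReal' 1 (by simp)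
    exact h1.comp_aemeasurable hG
  · have h2 := integral_map hG (f := fun x : ℝ => x) (by fun_prop)
    rw [← h2, (h.law_gaussian n).map_eq, integral_id_gaussianReal]

/-- All weights are known from time 0; each increment multiplies a known weight by a centred
Gaussian independent of the past. -/
lemma IsModel.martingale_sum_Ico [IsProbabilityMeasure μ] (h : IsModel H ρ Γ G X f B μ) (P : ℕ)
    (t : ℝ≥0) (hint : ∀ i, P ≤ i → Integrable (fun ω => weight α Γ X f i ω t * G i ω) μ) :
    Martingale (fun n ω => ∑ i ∈ Finset.Ico P (P + n), weight α Γ X f i ω t * G i ω)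
      (h.gaussianFiltration P) μ := by
  refine martingale_of_condExp_sub_eq_zero_nat (fun n => ?_) (fun n => ?_) (fun n => ?_)
  · refine Measurable.stronglyMeasurable ?_
    refine Finset.measurable_fun_sum _ fun i hi => Measurable.mul ?_ ?_
    · exact measurable_weight_sourcesSigma (by simp) (by simp) (by simp) t
    · refine measurable_gaussian_sourcesSigma fun j hj => ?_
      rw [← Source.gaussian.inj hj]
      exact (Finset.mem_Ico.1 hi).2
  · exact integrable_finsetSum _ fun i hi => hint i (Finset.mem_Ico.1 hi).1
  · have e : ((fun ω => ∑ i ∈ Finset.Ico P (P + (n + 1)), weight α Γ X f i ω t * G i ω) -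
        fun ω => ∑ i ∈ Finset.Ico P (P + n), weight α Γ X f i ω t * G i ω) =
        (fun ω => weight α Γ X f (P + n) ω t) * G (P + n) := by
      ext ω
      simp only [Pi.sub_apply, Pi.mul_apply]
      rw [← add_assoc, Finset.sum_Ico_succ_top (Nat.le_add_right P n), add_sub_cancel_left]
    rw [e]
    have h1 : StronglyMeasurable[h.gaussianFiltration P n]
        fun ω => weight α Γ X f (P + n) ω t :=
      (measurable_weight_sourcesSigma (by simp) (by simp) (by simp) t).stronglyMeasurable
    have h2 := condExp_mul_of_stronglyMeasurable_left h1 (hint (P + n) (Nat.le_add_right P n))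
      (h.integral_gaussian (P + n)).1
    have hdisj : Disjoint {Source.gaussian (P + n)}
        {s : Source | ∀ i, s = Source.gaussian i → i < P + n} :=
      Set.disjoint_singleton_left.2 fun hs => lt_irrefl _ (hs _ rfl)
    have hind := h.indep_sourcesSigma hdisj
    have hmG : StronglyMeasurable[sourcesSigma Γ G X f {Source.gaussian (P + n)}] (G (P + n)) :=
      (measurable_gaussian_sourcesSigma (Set.mem_singleton _)).stronglyMeasurable
    have h3 : μ[G (P + n) | h.gaussianFiltration P n] =ᵐ[μ] fun _ => μ[G (P + n)] :=
      condExp_indep_eq (h.sourcesSigma_le _) ((h.gaussianFiltration P).le n) hmG hind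
    filter_upwards [h2, h3] with ω hω2 hω3
    rw [hω2, Pi.mul_apply, hω3, (h.integral_gaussian (P + n)).2, mul_zero, Pi.zero_apply]

lemma IsModel.ae_exists_tendsto_sum [IsProbabilityMeasure μ] (h : IsModel H ρ Γ G X f B μ)
    (hα : 0 < α) (hα2 : α < 2) (t : ℝ≥0) :
    ∀ᵐ ω ∂μ, ∃ c, Tendsto (fun N => ∑ i ∈ Finset.range N, weight α Γ X f i ω t * G i ω) atTop
      (𝓝 c) := by
  obtain ⟨C, hC0, hC⟩ := h.lintegral_sum_Ico_rpow_le hα hα2 t (q := 2) le_rfl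
  -- The first weights may lack second moments, so the martingale starts at P; the omitted finite
  -- sum does not affect convergence.
  obtain ⟨P, hP⟩ := exists_nat_gt (2 / α)
  have hP1 : 1 ≤ P := by
    have : (0 : ℝ) < P := lt_trans (by positivity) hP
    exact_mod_cast this
  have hmeas : ∀ a b : ℕ, Measurable fun ω =>
      ∑ i ∈ Finset.Ico a b, weight α Γ X f i ω t * G i ω := fun a b =>
    Finset.measurable_fun_sum _ fun i _ => (h.measurable_weight i t).mul (h.measurable_gaussian i)
  have hL1 : ∀ a b : ℕ, P ≤ a →
      eLpNorm (fun ω => ∑ i ∈ Finset.Ico a b, weight α Γ X f i ω t * G i ω) 1 μ ≤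
        (ENNReal.ofReal C) ^ (1 / 2 : ℝ) := by
    intro a b ha
    have ha1 : (1 : ℝ) ≤ a := by exact_mod_cast hP1.trans ha
    have hPa : (P : ℝ) ≤ a := by exact_mod_cast ha
    have h2a : 2 < ((a : ℝ) + 1) * α := by
      rw [div_lt_iff₀ hα] at hP
      exact hP.trans_le (by gcongr; linarith)
    refine (eLpNorm_le_eLpNorm_of_exponent_le one_le_two
      (hmeas a b).aestronglyMeasurable).trans ?_
    rw [eLpNorm_eq_lintegral_rpow_enorm_toReal (by simp) (by simp)]
    simp only [ENNReal.toReal_ofNat]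
    gcongr
    refine (hC a b (hP1.trans ha) h2a t le_rfl).trans (ENNReal.ofReal_le_ofReal ?_)
    refine div_le_self hC0 (Real.one_le_rpow ha1 ?_)
    have : 0 < 2 - α := by linarith
    positivity
  have hint : ∀ i, P ≤ i → Integrable (fun ω => weight α Γ X f i ω t * G i ω) μ := by
    intro i hi
    have h1 := hL1 i (i + 1) hi
    simp only [Nat.Ico_succ_singleton, Finset.sum_singleton] at h1
    rw [← memLp_one_iff_integrable]
    exact ⟨((h.measurable_weight i t).mul (h.measurable_gaussian i)).aestronglyMeasurable,
      h1.trans_lt (ENNReal.rpow_lt_top_of_nonneg (by norm_num) (by simp))⟩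
  have hconv := (h.martingale_sum_Ico P t hint).submartingale.exists_ae_tendsto_of_bdd
    (R := (C.toNNReal) ^ (1 / 2 : ℝ)) (fun n => by
      rw [ENNReal.coe_rpow_of_nonneg _ (by norm_num)]
      exact hL1 P (P + n) le_rfl)
  filter_upwards [hconv] with ω ⟨c, hω⟩
  refine ⟨_, (tendsto_add_atTop_iff_nat P).1 ((hω.const_add
    (∑ i ∈ Finset.range P, weight α Γ X f i ω t * G i ω)).congr fun n => ?_)⟩
  rw [Finset.sum_Ico_eq_sub _ (Nat.le_add_right P n), add_comm n P]
  ring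

end Convergence

/-! ### From blocks at fixed t to the norm of the tail on K. -/

section TailBound

lemma lebesgueHalfLine_lt_top_of_isCompact {K : Set ℝ≥0} (hK : IsCompact K) :
    lebesgueHalfLine K < ∞ := by
  have he : MeasurableEmbedding ((↑) : ℝ≥0 → ℝ) :=
    MeasurableEmbedding.subtype_coe measurableSet_Ici
  rw [lebesgueHalfLine, he.comap_apply]
  exact (hK.image NNReal.continuous_coe).measure_lt_top

lemma lpNormOn_rpow_le {K : Set ℝ≥0} {p q : ℝ} (hp : 0 < p) (hpq : p ≤ q) {g : ℝ≥0 → ℝ}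
    (hg : Measurable g) :
    lpNormOn K p g ^ q ≤
      (∫⁻ t in K, ‖g t‖ₑ ^ q ∂lebesgueHalfLine) * lebesgueHalfLine K ^ (q / p - 1) := by
  have hq : 0 < q := hp.trans_le hpq
  have h1 := eLpNorm_le_eLpNorm_mul_rpow_measure_univ (μ := lebesgueHalfLine.restrict K)
    (ENNReal.ofReal_le_ofReal hpq) hg.aestronglyMeasurable
  rw [ENNReal.toReal_ofReal hp.le, ENNReal.toReal_ofReal hq.le, Measure.restrict_apply_univ] at h1
  rw [lpNormOn]
  refine (ENNReal.rpow_le_rpow h1 hq.le).trans_eq ?_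
  rw [ENNReal.mul_rpow_of_nonneg _ _ hq.le, ← ENNReal.rpow_mul,
    eLpNorm_eq_lintegral_rpow_enorm_toReal (by simpa using hq) (by simp),
    ENNReal.toReal_ofReal hq.le, ← ENNReal.rpow_mul, one_div_mul_cancel hq.ne', ENNReal.rpow_one]
  congr 2
  field_simp

lemma lintegral_lpNormOn_rpow_le {Ω : Type*} [MeasurableSpace Ω] {μ : Measure Ω} [SFinite μ]
    {K : Set ℝ≥0} (hK : IsCompact K) {p q : ℝ} (hp : 0 < p) (hpq : p ≤ q) {b : ℝ≥0∞}
    {D : Ω → ℝ≥0 → ℝ} (hD : Measurable (Function.uncurry D))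
    (hb : ∀ t ∈ K, ∫⁻ ω, ‖D ω t‖ₑ ^ q ∂μ ≤ b) :
    ∫⁻ ω, lpNormOn K p (D ω) ^ q ∂μ ≤
      b * lebesgueHalfLine K * lebesgueHalfLine K ^ (q / p - 1) := by
  have : IsFiniteMeasure (lebesgueHalfLine.restrict K) :=
    isFiniteMeasure_restrict.2 (lebesgueHalfLine_lt_top_of_isCompact hK).ne
  have hDq : Measurable (Function.uncurry fun ω t => ‖D ω t‖ₑ ^ q) := hD.enorm.pow_const q
  calc _ ≤ ∫⁻ ω, (∫⁻ t in K, ‖D ω t‖ₑ ^ q ∂lebesgueHalfLine) *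
          lebesgueHalfLine K ^ (q / p - 1) ∂μ :=
        lintegral_mono fun ω => lpNormOn_rpow_le hp hpq (hD.comp measurable_prodMk_left)
    _ = (∫⁻ t in K, ∫⁻ ω, ‖D ω t‖ₑ ^ q ∂μ ∂lebesgueHalfLine) *
          lebesgueHalfLine K ^ (q / p - 1) := by
        rw [lintegral_mul_const _ (Measurable.lintegral_prod_right hDq),
          lintegral_lintegral_swap hDq.aemeasurable]
    _ ≤ (∫⁻ _ in K, b ∂lebesgueHalfLine) * lebesgueHalfLine K ^ (q / p - 1) :=
        mul_le_mul' (setLIntegral_mono' hK.measurableSet hb) le_rfl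
    _ = _ := by rw [setLIntegral_const]

variable {Ω : Type*} [MeasurableSpace Ω] {μ : Measure Ω} {H ρ α : ℝ} {Γ G X : ℕ → Ω → ℝ}
  {f : ℕ → Ω → ℝ → ℝ≥0 → ℝ} {B : ℕ → ℝ≥0 → Ω → ℝ}

/-- The sum of the series, with the random functions evaluated through grids. -/
noncomputable def gridSeries {Ω : Type*} (α : ℝ) (Γ G X : ℕ → Ω → ℝ)
    (f : ℕ → Ω → ℝ → ℝ≥0 → ℝ) (ω : Ω) (t : ℝ≥0) : ℝ :=
  limUnder atTop fun N => ∑ i ∈ Finset.range N, weight α Γ X f i ω t * G i ω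

lemma IsModel.measurable_uncurry_weight (h : IsModel H ρ Γ G X f B μ) (n : ℕ) :
    Measurable fun z : Ω × ℝ≥0 => weight α Γ X f n z.1 z.2 := by
  have hfst : Measurable (Prod.fst : Ω × ℝ≥0 → Ω) := measurable_fst
  have hX := (h.measurable_laplace n).comp hfst
  have h1 := measurable_gridEval hX measurable_snd ((h.measurable_field n).comp hfst)
  exact (((h.arrivals.measurable n).comp measurable_fst).pow_const _).mul
    (((hX.abs.const_mul 2).div_const α).exp.mul h1)

lemma IsModel.measurable_uncurry_sum (h : IsModel H ρ Γ G X f B μ) (s : Finset ℕ) :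
    Measurable fun z : Ω × ℝ≥0 => ∑ i ∈ s, weight α Γ X f i z.1 z.2 * G i z.1 :=
  Finset.measurable_fun_sum _ fun i _ => (h.measurable_uncurry_weight i).mul
    ((h.measurable_gaussian i).comp measurable_fst)

lemma IsModel.measurable_uncurry_gridSeries (h : IsModel H ρ Γ G X f B μ) :
    Measurable fun z : Ω × ℝ≥0 => gridSeries α Γ G X f z.1 z.2 :=
  (StronglyMeasurable.limUnder fun N =>
    (h.measurable_uncurry_sum (Finset.range N)).stronglyMeasurable).measurable

/-- One null set serves all t, so whole paths may be exchanged inside the norm. -/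
lemma IsModel.ae_truncatedSeries_eq (h : IsModel H ρ Γ G X f B μ) :
    ∀ᵐ ω ∂μ, ∀ N t, truncatedSeries α Γ G X f N ω t =
      ∑ i ∈ Finset.range N, weight α Γ X f i ω t * G i ω := by
  filter_upwards [ae_all_iff.2 h.field_continuous] with ω hω N t
  refine Finset.sum_congr rfl fun i _ => ?_
  rw [weight, shot, gridEval_eq_of_continuous (hω i)]
  ring

lemma IsModel.ae_series_eq (h : IsModel H ρ Γ G X f B μ) :
    ∀ᵐ ω ∂μ, ∀ t, series α Γ G X f ω t = gridSeries α Γ G X f ω t := by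
  filter_upwards [h.ae_truncatedSeries_eq (α := α)] with ω hω t
  simp_rw [series, gridSeries, hω]

lemma IsModel.ae_tendsto_gridSeries [IsProbabilityMeasure μ] (h : IsModel H ρ Γ G X f B μ)
    (hα : 0 < α) (hα2 : α < 2) (t : ℝ≥0) :
    ∀ᵐ ω ∂μ, Tendsto (fun N => ∑ i ∈ Finset.range N, weight α Γ X f i ω t * G i ω) atTop
      (𝓝 (gridSeries α Γ G X f ω t)) := by
  filter_upwards [h.ae_exists_tendsto_sum hα hα2 t] with ω hω
  exact tendsto_nhds_limUnder hω

lemma IsModel.lintegral_gridSeries_sub_rpow_le [IsProbabilityMeasure μ]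
    (h : IsModel H ρ Γ G X f B μ) (hα : 0 < α) (hα2 : α < 2) {q : ℝ} {P : ℕ}
    {t : ℝ≥0} {b : ℝ≥0∞}
    (hb : ∀ N, ∫⁻ ω, ‖∑ i ∈ Finset.Ico P N, weight α Γ X f i ω t * G i ω‖ₑ ^ q ∂μ ≤ b) :
    ∫⁻ ω, ‖gridSeries α Γ G X f ω t -
      ∑ i ∈ Finset.range P, weight α Γ X f i ω t * G i ω‖ₑ ^ q ∂μ ≤ b := by
  have hlim : ∀ᵐ ω ∂μ, Tendsto
      (fun n => ‖∑ i ∈ Finset.Ico P (n + P), weight α Γ X f i ω t * G i ω‖ₑ ^ q) atTop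
      (𝓝 (‖gridSeries α Γ G X f ω t -
        ∑ i ∈ Finset.range P, weight α Γ X f i ω t * G i ω‖ₑ ^ q)) := by
    filter_upwards [h.ae_tendsto_gridSeries hα hα2 t] with ω hω
    refine (ENNReal.continuous_rpow_const.tendsto _).comp (Tendsto.enorm ?_)
    refine (((tendsto_add_atTop_iff_nat P).2 hω).sub_const _).congr fun n => ?_
    rw [Finset.sum_Ico_eq_sub _ (Nat.le_add_left P n)]
  -- Fatou, along blocks from P to n + P.
  calc _ = ∫⁻ ω, liminf
        (fun n => ‖∑ i ∈ Finset.Ico P (n + P), weight α Γ X f i ω t * G i ω‖ₑ ^ q) atTop ∂μ :=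
        lintegral_congr_ae (hlim.mono fun ω hω => hω.liminf_eq.symm)
    _ ≤ _ := lintegral_liminf_le fun n =>
        (Finset.measurable_fun_sum _ fun i _ =>
          (h.measurable_weight i t).mul (h.measurable_gaussian i)).enorm.pow_const q
    _ ≤ b := (liminf_le_liminf (Eventually.of_forall fun n => hb (n + P))).trans_eq (liminf_const _)

lemma IsModel.lintegral_lpNormOn_sub_rpow_le [IsProbabilityMeasure μ]
    (h : IsModel H ρ Γ G X f B μ) (hα : 0 < α) (hα2 : α < 2) {K : Set ℝ≥0} (hK : IsCompact K)
    {p q : ℝ} (hp : 0 < p) (hpq : p ≤ q) {P : ℕ} {b : ℝ≥0∞}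
    (hb : ∀ N, ∀ t ∈ K,
      ∫⁻ ω, ‖∑ i ∈ Finset.Ico P N, weight α Γ X f i ω t * G i ω‖ₑ ^ q ∂μ ≤ b) :
    ∫⁻ ω, (lpNormOn K p (fun t =>
        series α Γ G X f ω t - truncatedSeries α Γ G X f P ω t)) ^ q ∂μ ≤
      b * lebesgueHalfLine K * lebesgueHalfLine K ^ (q / p - 1) := by
  have hDm : Measurable (Function.uncurry fun ω t => gridSeries α Γ G X f ω t -
      ∑ i ∈ Finset.range P, weight α Γ X f i ω t * G i ω) :=
    h.measurable_uncurry_gridSeries.sub (h.measurable_uncurry_sum (Finset.range P))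
  refine (lintegral_congr_ae ?_).trans_le (lintegral_lpNormOn_rpow_le hK hp hpq hDm fun t ht =>
    h.lintegral_gridSeries_sub_rpow_le hα hα2 fun N => hb N t ht)
  filter_upwards [h.ae_series_eq (α := α), h.ae_truncatedSeries_eq (α := α)] with ω h1 h2
  simp only [h1, h2]

end TailBound

end ShotNoise

/-! ### Conclusion. -/

theorem mainTheorem11 {Ω : Type*} [MeasurableSpace Ω] (μ : Measure Ω) [IsProbabilityMeasure μ]
    (α H ρ : ℝ) (hα : 0 < α ∧ α < 2) (hH : 0 < H ∧ H < 1) (hρ : 0 ≤ ρ)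
    (Γ G X : ℕ → Ω → ℝ) (f : ℕ → Ω → ℝ → ℝ≥0 → ℝ) (B : ℕ → ℝ≥0 → Ω → ℝ)
    (hmodel : ShotNoise.IsModel H ρ Γ G X f B μ) :
    (∀ t : ℝ≥0, ∀ᵐ ω ∂μ, Tendsto (fun N => ShotNoise.truncatedSeries α Γ G X f N ω t) atTop
      (𝓝 (ShotNoise.series α Γ G X f ω t))) ∧
    ∀ K : Set ℝ≥0, IsCompact K → ∀ p q : ℝ, 0 < p → max p 2 < q →
      ∃ C : ℝ, ∀ P : ℕ, q < ((P : ℝ) + 1) * α →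
        ∫⁻ ω, (ShotNoise.lpNormOn K p (fun t =>
            ShotNoise.series α Γ G X f ω t - ShotNoise.truncatedSeries α Γ G X f P ω t)) ^ q ∂μ
          ≤ ENNReal.ofReal (C / (P : ℝ) ^ (q * ((2 - α) / (2 * α)))) := by
  refine ⟨fun t => ?_, fun K hK p q hp hq => ?_⟩
  · filter_upwards [hmodel.ae_tendsto_gridSeries hα.1 hα.2 t,
      hmodel.ae_series_eq (α := α), hmodel.ae_truncatedSeries_eq (α := α)] with ω h1 h2 h3
    simp_rw [h2, h3]
    exact h1
  · have hpq : p < q := (le_max_left p 2).trans_lt hq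
    have h2q : 2 < q := (le_max_right p 2).trans_lt hq
    obtain ⟨T, hT⟩ := hK.bddAbove
    obtain ⟨C, hC0, hC⟩ := hmodel.lintegral_sum_Ico_rpow_le hα.1 hα.2 T h2q.le
    set v := ShotNoise.lebesgueHalfLine K with hv
    have hvt : v ≠ ∞ := (ShotNoise.lebesgueHalfLine_lt_top_of_isCompact hK).ne
    have hexp : 0 ≤ q / p - 1 := by
      rw [sub_nonneg, one_le_div hp]; exact hpq.le
    have hwt : v * v ^ (q / p - 1) ≠ ∞ :=
      ENNReal.mul_ne_top hvt (ENNReal.rpow_ne_top_of_nonneg hexp hvt)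
    refine ⟨C * (v * v ^ (q / p - 1)).toReal, fun P hP => ?_⟩
    -- For P = 0 the condition would read q < α < 2 < q.
    have hP1 : 1 ≤ P := by
      by_contra hlt
      rw [Nat.lt_one_iff.1 (not_le.1 hlt)] at hP
      norm_num at hP
      linarith [hα.2]
    refine (hmodel.lintegral_lpNormOn_sub_rpow_le hα.1 hα.2 hK hp hpq.le
      fun N t ht => hC P N hP1 hP t (hT ht)).trans_eq ?_
    rw [mul_assoc, ← ENNReal.ofReal_toReal hwt, ← ENNReal.ofReal_mul (by positivity),
      ENNReal.toReal_ofReal (by positivity)]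
    congr 1
    ring
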